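/- Let $M$ be a matroid on a finite set $E$, with rank function $\mathrm{rk}$, $\mathrm{rk}\,M=\mathrm{rk}(E)$, closure operator $\mathrm{cl}$, and lattice of flats $\mathcal L$. Put $$\chi_M(q)=\sum_{S\subseteq E}(-1)^{\#S}q^{\mathrm{rk}\,M-\mathrm{rk}\,S},\qquad \overline\chi_M(q)=\sum_{S\subseteq E}(-1)^{\#S}\,[\mathrm{rk}\,M-\mathrm{rk}\,S]_q,\qquad [n]_q=1+q+\dots+q^{n-1},$$ so that $\overline\chi_M(q)=\chi_M(q)/(q-1)$ if $E\neq\emptyset$. For $w\in\mathbb R^E$ let $|w|=\sum_e w_e$, let $\mathrm{wt}_M(w)$ be the maximum of $\sum_{e\in B}w_e$ over the bases $B$ of $M$, and let $M_w$ be the matroid on $E$ whose bases are the bases of $M$ attaining this maximum. For $v\in\mathbb Z^E/\mathbb Z\mathbf 1$ with any lift $w\in\mathbb Z^E$ let $M_v=M_w$, $\overline{\mathrm{wt}}_M(v)=\mathrm{wt}_M(w)-(\mathrm{rk}\,M)\min(w)$ and $\overline{|v|}=|w|-(\#E)\min(w)$. Define in $\mathbb Z[q^{\pm1}][[T]]$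 $$Z_M=\sum_{w\in\mathbb Z_{\ge0}^E}\chi_{M_w}(q)\,q^{-\mathrm{rk}\,M-\mathrm{wt}_M(w)}T^{|w|},\qquad Z^0_M=\sum_{w\in\mathbb Z_{>0}^E}\chi_{M_w}(q)\,q^{-\mathrm{rk}\,M-\mathrm{wt}_M(w)}T^{|w|},$$ $$\overline Z_M=\sum_{v\in\mathbb Z^E/\mathbb Z\mathbf 1}\overline\chi_{M_v}(q)\,q^{-(\mathrm{rk}\,M-1)-\overline{\mathrm{wt}}_M(v)}T^{\overline{|v|}}.$$ A subset $\mathscr G\subseteq\mathcal L_{>\mathrm{cl}(\emptyset)}$ is a building set if for every flat $X>\mathrm{cl}(\emptyset)$, writing $\mathrm{fact}_{\mathscr G}(X)=\max\mathscr G_{\le X}=\{G_1,\dots,G_k\}$ for the set of maximal elements of $\{G\in\mathscr G\mid G\le X\}$, there is an isomorphism of posets $\prod_{i=1}^k[\mathrm{cl}(\emptyset),G_i]\cong[\mathrm{cl}(\emptyset),X]$ sending $(\mathrm{cl}(\emptyset),\dots,G_i,\dots,\mathrm{cl}(\emptyset))$ to $G_i$ for each $i$. A subset $\mathcal S\subseteq\mathscr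 G$ is nested if no join of $t\ge2$ distinct pairwise incomparable elements of $\mathcal S$ lies in $\mathscr G$. Let $\mathcal N(M,\mathscr G)$ be the set of nested sets, $\mathcal N^*(M,\mathscr G)$ the set of those that contain $\max\mathscr G_{\le E}$, and $\mathcal N^\circ=\mathcal N\setminus\mathcal N^*$. For $\mathcal S\in\mathcal N(M,\mathscr G)$ let $\sigma_{\mathcal S}\subseteq\mathbb R^E$ be the cone generated by the indicator vectors $v_F$ of the flats $F\in\mathcal S$, and let $M_{\mathcal S}=M_w$ for any $w$ in the relative interior of $\sigma_{\mathcal S}$. Then, for every building set $\mathscr G$ in $\mathcal L$: $M_{\mathcal S}$ is well defined for every $\mathcal S\in\mathcal N(M,\mathscr G)$; $(q-1)^{\#\mathcal S}$ divides $\chi_{M_{\mathcal S}}(q)$ in $\mathbb Z[q]$ for $\mathcal S\in\mathcal N(M,\mathscr G)$ and divides $\overline\chi_{M_{\mathcal S}}(q)$ for $\mathcal S\in\mathcal N^\circ(M,\mathscr G)$; and in $\mathbb Z[q^{\pm1}][[T]]$ $$Z_M=q^{-\mathrm{rk}\,M}\sum_{\mathcal S\in\mathcal N(M,\mathscr G)}\frac{\chi_{M_{\mathcal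 S}}(q)}{(q-1)^{\#\mathcal S}}\prod_{F\in\mathcal S}(q-1)\frac{q^{-\mathrm{rk}F}T^{\#F}}{1-q^{-\mathrm{rk}F}T^{\#F}},$$ $$Z^0_M=q^{-\mathrm{rk}\,M}\sum_{\mathcal S\in\mathcal N^*(M,\mathscr G)}\frac{\chi_{M_{\mathcal S}}(q)}{(q-1)^{\#\mathcal S}}\prod_{F\in\mathcal S}(q-1)\frac{q^{-\mathrm{rk}F}T^{\#F}}{1-q^{-\mathrm{rk}F}T^{\#F}},$$ $$\overline Z_M=q^{-(\mathrm{rk}\,M-1)}\sum_{\mathcal S\in\mathcal N^\circ(M,\mathscr G)}\frac{\overline\chi_{M_{\mathcal S}}(q)}{(q-1)^{\#\mathcal S}}\prod_{F\in\mathcal S}(q-1)\frac{q^{-\mathrm{rk}F}T^{\#F}}{1-q^{-\mathrm{rk}F}T^{\#F}}.$$ Consequently each of the three right-hand sides is the same for any two building sets in $\mathcal L$. -/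

import Mathlib

namespace MotivicZeta

noncomputable section

/-! ### Rank and characteristic polynomials

Every matroid below lives on a finite type `E`; in the theorem its ground set is all of `E`. -/

/-- The rank of a set, as a natural number. -/
def rk {E : Type*} (M : Matroid E) (S : Set E) : ℕ := (M.eRk S).toNat

/-- The rank of the matroid. -/
def rank {E : Type*} (M : Matroid E) : ℕ := rk M M.E

/-- The subsets of the ground set. -/
def groundSubsets {E : Type*} [Fintype E] (M : Matroid E) : Finset (Finset E) :=
  (Set.toFinite M.E).toFinset.powerset

/-- The characteristic polynomial `∑_{S ⊆ E} (-1)^{#S} q^{rk M - rk S}`. -/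
def charPoly {E : Type*} [Fintype E] (M : Matroid E) : Polynomial ℤ :=
  ∑ S ∈ groundSubsets M, (-1) ^ S.card * Polynomial.X ^ (rank M - rk M (S : Set E))

/-- The `q`-analogue `[n]_q = 1 + q + ⋯ + q^{n-1}`. -/
def qInt (n : ℕ) : Polynomial ℤ := ∑ i ∈ Finset.range n, Polynomial.X ^ i

/-- The reduced characteristic polynomial `∑_{S ⊆ E} (-1)^{#S} [rk M - rk S]_q`. -/
def redCharPoly {E : Type*} [Fintype E] (M : Matroid E) : Polynomial ℤ :=
  ∑ S ∈ groundSubsets M, (-1) ^ S.card * qInt (rank M - rk M (S : Set E))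

/-- On a nonempty ground set the reduced characteristic polynomial is `χ_M(q) / (q - 1)`. -/
theorem redCharPoly_mul {E : Type*} [Fintype E] (M : Matroid E) (hE : M.E.Nonempty) :
    redCharPoly M * (Polynomial.X - 1) = charPoly M := by
  have h : ∑ S ∈ groundSubsets M, ((-1) ^ S.card : Polynomial ℤ) = 0 := by
    have h1 := Finset.sum_powerset_neg_one_pow_card_of_nonempty
      (x := (Set.toFinite M.E).toFinset) (by simpa using hE)
    have h2 := congrArg (Int.castRingHom (Polynomial ℤ)) h1
    simpa [groundSubsets] using h2
  calc redCharPoly M * (Polynomial.X - 1)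
      = ∑ S ∈ groundSubsets M,
          ((-1) ^ S.card * Polynomial.X ^ (rank M - rk M (S : Set E)) - (-1) ^ S.card) := by
        rw [redCharPoly, Finset.sum_mul]
        refine Finset.sum_congr rfl fun S _ => ?_
        rw [mul_assoc, qInt, geom_sum_mul, mul_sub, mul_one]
    _ = charPoly M := by rw [Finset.sum_sub_distrib, h, sub_zero, charPoly]

/-! ### Weights and initial matroids -/

/-- `∑_{e ∈ B} w_e`. -/
def setWeight {E R : Type*} [Fintype E] [AddCommGroup R] (w : E → R) (B : Set E) : R :=
  ∑ e, B.indicator w e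

/-- The finite set of bases. -/
def bases {E : Type*} [Fintype E] (M : Matroid E) : Finset (Set E) :=
  (Set.toFinite {B | M.IsBase B}).toFinset

theorem mem_bases {E : Type*} [Fintype E] {M : Matroid E} {B : Set E} :
    B ∈ bases M ↔ M.IsBase B := by simp [bases]

theorem bases_nonempty {E : Type*} [Fintype E] (M : Matroid E) : (bases M).Nonempty := by
  obtain ⟨B, hB⟩ := M.exists_isBase
  exact ⟨B, mem_bases.2 hB⟩

/-- `wt_M(w)`, the maximum of `∑_{e ∈ B} w_e` over the bases `B` of `M`. -/
def wt {E R : Type*} [Fintype E] [AddCommGroup R] [LinearOrder R]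
    (M : Matroid E) (w : E → R) : R :=
  (bases M).sup' (bases_nonempty M) (setWeight w)

theorem setWeight_le_wt {E R : Type*} [Fintype E] [AddCommGroup R] [LinearOrder R]
    {M : Matroid E} (w : E → R) {B : Set E} (hB : M.IsBase B) : setWeight w B ≤ wt M w :=
  Finset.le_sup' (setWeight w) (mem_bases.2 hB)

theorem setWeight_exchange {E R : Type*} [Fintype E] [AddCommGroup R] (w : E → R) {B : Set E}
    {e f : E} (he : e ∈ B) (hf : f ∉ B) :
    setWeight w (insert f (B \ {e})) = setWeight w B - w e + w f := by
  classical
  have h1 : setWeight w B = w e + setWeight w (B \ {e}) := by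
    unfold setWeight
    rw [← Finset.add_sum_erase _ _ (Finset.mem_univ e),
      ← Finset.add_sum_erase (Finset.univ) ((B \ {e}).indicator w) (Finset.mem_univ e)]
    simp only [Set.indicator_of_mem he, Set.mem_sdiff, Set.mem_singleton_iff, not_true_eq_false,
      and_false, not_false_eq_true, Set.indicator_of_notMem, zero_add]
    congr 1
    refine Finset.sum_congr rfl fun x hx => ?_
    have hx' := (Finset.mem_erase.1 hx).1
    simp [Set.indicator, hx']
  have h2 : setWeight w (insert f (B \ {e})) = w f + setWeight w (B \ {e}) := by
    unfold setWeight
    have hf' : f ∉ B \ {e} := fun h => hf h.1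
    rw [← Finset.add_sum_erase _ _ (Finset.mem_univ f),
      ← Finset.add_sum_erase (Finset.univ) ((B \ {e}).indicator w) (Finset.mem_univ f)]
    rw [Set.indicator_of_mem (Set.mem_insert f _), Set.indicator_of_notMem hf', zero_add]
    congr 1
    refine Finset.sum_congr rfl fun x hx => ?_
    have hx' := (Finset.mem_erase.1 hx).1
    simp [Set.indicator, hx']
  rw [h1, h2]; abel

theorem symm_exchange {E : Type*} {M : Matroid E} {B B' : Set E} (hB : M.IsBase B)
    (hB' : M.IsBase B') {e : E} (he : e ∈ B) (he' : e ∉ B') :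
    ∃ f, f ∈ B' ∧ f ∉ B ∧ M.IsBase (insert f (B \ {e})) ∧ M.IsBase (insert e (B' \ {f})) := by
  have heE : e ∈ M.E := hB.subset_ground he
  have hecl : e ∈ M.closure B' := by rwa [hB'.closure_eq]
  have hC : M.IsCircuit (M.fundCircuit e B') := hB'.fundCircuit_isCircuit heE he'
  have hnot : ¬ (M.fundCircuit e B' \ {e}) ⊆ M.closure (B \ {e}) := by
    intro hsub
    have h1 : e ∈ M.closure (M.fundCircuit e B' \ {e}) :=
      hC.mem_closure_sdiff_singleton_of_mem (M.mem_fundCircuit e B')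
    have h2 := M.closure_subset_closure_of_subset_closure hsub h1
    exact hB.indep.notMem_closure_sdiff_of_mem he h2
  obtain ⟨f, ⟨hfC, hfe⟩, hfcl⟩ := Set.not_subset.1 hnot
  have hfe' : f ≠ e := hfe
  have hfB' : f ∈ B' := (M.fundCircuit_subset_insert e B' hfC).resolve_left hfe'
  have hfB : f ∉ B := fun h =>
    hfcl (M.subset_closure (B \ {e}) (Set.sdiff_subset.trans hB.subset_ground) ⟨h, hfe⟩)
  have hBf : M.IsBase (insert f (B \ {e})) :=
    hB.exchange_base_of_notMem_closure he hfcl (hB'.subset_ground hfB')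
  refine ⟨f, hfB', hfB, hBf, ?_⟩
  have hi := (hB'.indep.mem_fundCircuit_iff hecl he').1 hfC
  rw [Set.insert_sdiff_singleton_comm hfe'.symm]
  exact hB'.exchange_isBase_of_indep' hfB' he' hi

/-- The matroid `M_w`, whose bases are the bases of `M` of maximal `w`-weight. -/
def initial {E R : Type*} [Fintype E] [AddCommGroup R] [LinearOrder R] [IsOrderedAddMonoid R]
    (M : Matroid E) (w : E → R) : Matroid E :=
  Matroid.ofIsBaseOfFinite (E := M.E) (Set.toFinite _)
    (fun B => M.IsBase B ∧ setWeight w B = wt M w)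
    (by
      obtain ⟨B, hB, h⟩ := Finset.exists_mem_eq_sup' (bases_nonempty M) (setWeight w)
      exact ⟨B, mem_bases.1 hB, h.symm⟩)
    (by
      rintro B B' ⟨hB, hw⟩ ⟨hB', hw'⟩ e ⟨he, he'⟩
      obtain ⟨f, hf, hf', h1, h2⟩ := symm_exchange hB hB' he he'
      refine ⟨f, ⟨hf, hf'⟩, h1, ?_⟩
      have g1 := setWeight_le_wt w h1
      have g2 := setWeight_le_wt w h2
      rw [setWeight_exchange w he hf', hw] at g1
      rw [setWeight_exchange w hf he', hw'] at g2
      have hef : w f = w e := by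
        apply le_antisymm
        · rwa [sub_add, sub_le_self_iff, sub_nonneg] at g1
        · rwa [sub_add, sub_le_self_iff, sub_nonneg] at g2
      rw [setWeight_exchange w he hf', hw, hef, sub_add_cancel])
    (fun B hB => hB.1.subset_ground)

/-! ### Zeta functions -/

/-- The ring `ℤ[q^{±1}]⟦T⟧`. -/
abbrev ZqT : Type := PowerSeries (LaurentPolynomial ℤ)

/-- The power series `∑_{i ∈ A} c_i T^{deg i}`: the coefficient of `T^n` is the sum of `c_i` over
the (finitely many) `i ∈ A` with `deg i = n`. -/
def formalSum {ι : Type*} (A : Set ι) (deg : ι → ℤ) (c : ι → LaurentPolynomial ℤ) : ZqT :=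
  PowerSeries.mk fun n => ∑ᶠ i ∈ {i | i ∈ A ∧ deg i = (n : ℤ)}, c i

/-- `|w| = ∑_e w_e`. -/
def size {E : Type*} [Fintype E] (w : E → ℤ) : ℤ := ∑ e, w e

/-- The summand `χ_{M_w}(q) q^{-rk M - wt_M(w)}`. -/
def zetaCoeff {E : Type*} [Fintype E] (M : Matroid E) (w : E → ℤ) : LaurentPolynomial ℤ :=
  (charPoly (initial M w)).toLaurent * LaurentPolynomial.T (-(rank M : ℤ) - wt M w)

/-- The motivic zeta function: the sum over `w ∈ ℤ_{≥ 0}^E`. -/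
def zeta {E : Type*} [Fintype E] (M : Matroid E) : ZqT :=
  formalSum {w : E → ℤ | ∀ e, 0 ≤ w e} size (zetaCoeff M)

/-- The local motivic zeta function: the sum over `w ∈ ℤ_{> 0}^E`. -/
def localZeta {E : Type*} [Fintype E] (M : Matroid E) : ZqT :=
  formalSum {w : E → ℤ | ∀ e, 0 < w e} size (zetaCoeff M)

/-- The quotient group `ℤ^E / ℤ𝟏`. -/
abbrev ProjLattice (E : Type*) : Type _ := (E → ℤ) ⧸ AddSubgroup.zmultiples (1 : E → ℤ)

theorem exists_of_rel {E : Type*} {w w' : E → ℤ}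
    (h : QuotientAddGroup.leftRel (AddSubgroup.zmultiples (1 : E → ℤ)) w w') :
    ∃ c : ℤ, w' = fun e => w e + c := by
  rw [QuotientAddGroup.leftRel_apply, AddSubgroup.mem_zmultiples_iff] at h
  obtain ⟨c, hc⟩ := h
  refine ⟨c, funext fun e => ?_⟩
  have := congrFun hc e
  simp at this
  omega

theorem iInf_add_const {E : Type*} [Fintype E] [Nonempty E] (w : E → ℤ) (c : ℤ) :
    (⨅ e, (w e + c)) = (⨅ e, w e) + c :=
  (ciInf_add (Set.finite_range w).bddBelow c).symm

theorem ncard_isBase {E : Type*} [Fintype E] {M : Matroid E} {B : Set E} (hB : M.IsBase B) :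
    B.ncard = rank M := by
  rw [rank, rk, ← Matroid.eRank_def, ← hB.encard_eq_eRank, Set.ncard]

theorem setWeight_add_const {E : Type*} [Fintype E] (w : E → ℤ) (c : ℤ) (B : Set E) :
    setWeight (fun e => w e + c) B = setWeight w B + B.ncard * c := by
  classical
  have h : ∑ e, B.indicator (fun _ => c) e = B.ncard * c := by
    rw [Finset.sum_indicator_eq_sum_filter]
    simp [Set.ncard_eq_toFinset_card', Set.toFinset]
  rw [← h, setWeight, setWeight, ← Finset.sum_add_distrib]
  exact Finset.sum_congr rfl fun e _ => Set.indicator_add' B w (fun _ => c) ▸ rfl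

theorem wt_add_const {E : Type*} [Fintype E] (M : Matroid E) (w : E → ℤ) (c : ℤ) :
    wt M (fun e => w e + c) = wt M w + rank M * c := by
  apply le_antisymm
  · refine Finset.sup'_le _ _ fun B hB => ?_
    rw [setWeight_add_const, ncard_isBase (mem_bases.1 hB)]
    exact add_le_add_left (setWeight_le_wt w (mem_bases.1 hB)) _
  · obtain ⟨B, hB, h⟩ := Finset.exists_mem_eq_sup' (bases_nonempty M) (setWeight w)
    have h' : wt M w = setWeight w B := h
    rw [h', ← ncard_isBase (mem_bases.1 hB), ← setWeight_add_const]
    exact setWeight_le_wt _ (mem_bases.1 hB)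

theorem initial_add_const {E : Type*} [Fintype E] (M : Matroid E) (w : E → ℤ) (c : ℤ) :
    initial M (fun e => w e + c) = initial M w := by
  refine Matroid.ext_isBase rfl fun B _ => ?_
  simp only [initial]
  refine and_congr_right fun hB => ?_
  rw [setWeight_add_const, wt_add_const, ncard_isBase hB, add_left_inj]

/-- `M_v = M_w` for any lift `w` of `v ∈ ℤ^E / ℤ𝟏`. -/
def redInitial {E : Type*} [Fintype E] (M : Matroid E) (v : ProjLattice E) : Matroid E :=
  Quotient.liftOn' v (fun w => initial M w) fun w w' h => by
    obtain ⟨c, rfl⟩ := exists_of_rel h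
    exact (initial_add_const M w c).symm

/-- `wt_M(w) - (rk M) min(w)` for any lift `w` of `v ∈ ℤ^E / ℤ𝟏`. -/
def redWt {E : Type*} [Fintype E] (M : Matroid E) (v : ProjLattice E) : ℤ :=
  Quotient.liftOn' v (fun w => wt M w - rank M * ⨅ e, w e) fun w w' h => by
    obtain ⟨c, rfl⟩ := exists_of_rel h
    rcases isEmpty_or_nonempty E with hE | hE
    · rw [Subsingleton.elim (fun e => w e + c) w]
    · simp only [wt_add_const, iInf_add_const]
      ring

/-- `|w| - (#E) min(w)` for any lift `w` of `v ∈ ℤ^E / ℤ𝟏`. -/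
def redSize {E : Type*} [Fintype E] (v : ProjLattice E) : ℤ :=
  Quotient.liftOn' v (fun w => size w - Fintype.card E * ⨅ e, w e) fun w w' h => by
    obtain ⟨c, rfl⟩ := exists_of_rel h
    rcases isEmpty_or_nonempty E with hE | hE
    · rw [Subsingleton.elim (fun e => w e + c) w]
    · simp only [size, iInf_add_const, Finset.sum_add_distrib, Finset.sum_const,
        Finset.card_univ, nsmul_eq_mul]
      ring

/-- The reduced motivic zeta function: the sum over `v ∈ ℤ^E / ℤ𝟏`. -/
def redZeta {E : Type*} [Fintype E] (M : Matroid E) : ZqT :=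
  formalSum (Set.univ : Set (ProjLattice E)) redSize fun v =>
    (redCharPoly (redInitial M v)).toLaurent *
      LaurentPolynomial.T (-((rank M : ℤ) - 1) - redWt M v)

/-- The inner sums in `zeta` and `localZeta` are finite. -/
theorem finite_size_fiber {E : Type*} [Fintype E] (n : ℤ) :
    {w : E → ℤ | (∀ e, 0 ≤ w e) ∧ size w = n}.Finite := by
  classical
  refine (Set.finite_Icc (0 : E → ℤ) (fun _ => n)).subset ?_
  rintro w ⟨h0, hn⟩
  refine ⟨h0, fun e => ?_⟩
  rw [← hn]
  exact Finset.single_le_sum (f := w) (fun i _ => h0 i) (Finset.mem_univ e)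

/-- Every class in `ℤ^E / ℤ𝟏` has a lift with minimum `0`, so `redSize` is nonnegative. -/
theorem exists_lift {E : Type*} [Fintype E] (v : ProjLattice E) :
    ∃ w : E → ℤ, (∀ e, 0 ≤ w e) ∧ size w = redSize v ∧
      (QuotientAddGroup.mk w : ProjLattice E) = v := by
  induction v using QuotientAddGroup.induction_on with
  | H w =>
    refine ⟨fun e => w e - ⨅ e, w e, fun e => ?_, ?_, ?_⟩
    · exact sub_nonneg.2 (ciInf_le (Set.finite_range w).bddBelow e)
    · change _ = size w - Fintype.card E * ⨅ e, w e
      simp [size]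
    · refine QuotientAddGroup.eq.2 (AddSubgroup.mem_zmultiples_iff.2 ⟨⨅ e, w e, ?_⟩)
      funext e
      simp

theorem redSize_nonneg {E : Type*} [Fintype E] (v : ProjLattice E) : 0 ≤ redSize v := by
  obtain ⟨w, h0, h, -⟩ := exists_lift v
  rw [← h]
  exact Finset.sum_nonneg fun e _ => h0 e

/-- The inner sums in `redZeta` are finite. -/
theorem finite_redSize_fiber {E : Type*} [Fintype E] (n : ℤ) :
    {v : ProjLattice E | redSize v = n}.Finite := by
  refine ((finite_size_fiber (E := E) n).image QuotientAddGroup.mk).subset fun v hv => ?_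
  obtain ⟨w, h0, h, h'⟩ := exists_lift v
  exact ⟨w, ⟨h0, h.trans hv⟩, h'⟩

/-! ### Flats, building sets and nested sets -/

/-- The lattice of flats, ordered by inclusion. -/
abbrev Flat {E : Type*} (M : Matroid E) : Type _ := {F : Set E // M.IsFlat F}

/-- The minimal flat `cl(∅)`. -/
def botFlat {E : Type*} (M : Matroid E) : Flat M := ⟨M.closure ∅, M.isFlat_closure ∅⟩

/-- The maximal flat `E`. -/
def topFlat {E : Type*} (M : Matroid E) : Flat M := ⟨M.E, M.ground_isFlat⟩

/-- The join of a finite set of flats. -/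
def joinFlat {E : Type*} (M : Matroid E) (A : Finset (Flat M)) : Flat M :=
  ⟨M.closure (⋃ F ∈ A, F.1), M.isFlat_closure _⟩

/-- The set of factors `max 𝒢_{≤ X}`. -/
def factors {E : Type*} {M : Matroid E} (𝒢 : Set (Flat M)) (X : Flat M) : Set (Flat M) :=
  {G | Maximal (fun H => H ∈ 𝒢 ∧ H ≤ X) G}

/-- Building sets in the lattice of flats. -/
def IsBuildingSet {E : Type*} (M : Matroid E) (𝒢 : Set (Flat M)) : Prop :=
  (∀ G ∈ 𝒢, botFlat M < G) ∧
  ∀ X : Flat M, botFlat M < X →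
    ∃ φ : ((G : factors 𝒢 X) → Set.Icc (botFlat M) G.1) ≃o Set.Icc (botFlat M) X,
      ∀ (G : factors 𝒢 X) (x : (G : factors 𝒢 X) → Set.Icc (botFlat M) G.1),
        (x G).1 = G.1 → (∀ H, H ≠ G → (x H).1 = botFlat M) → (φ x).1 = G.1

/-- `S ⊆ 𝒢` is nested if no join of `t ≥ 2` pairwise incomparable elements of `S` is in `𝒢`. -/
def IsNested {E : Type*} {M : Matroid E} (𝒢 : Set (Flat M)) (S : Finset (Flat M)) : Prop :=
  (∀ F ∈ S, F ∈ 𝒢) ∧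
  ∀ A ⊆ S, 2 ≤ A.card → IsAntichain (· ≤ ·) (A : Set (Flat M)) → joinFlat M A ∉ 𝒢

/-- The nested set complex `𝒩(M, 𝒢)`. -/
def nested {E : Type*} [Fintype E] {M : Matroid E} (𝒢 : Set (Flat M)) :
    Finset (Finset (Flat M)) :=
  (Set.toFinite {S | IsNested 𝒢 S}).toFinset

/-- `𝒩*(M, 𝒢)`: the nested sets that contain all factors of `E`. -/
def nestedStar {E : Type*} [Fintype E] {M : Matroid E} (𝒢 : Set (Flat M)) :
    Finset (Finset (Flat M)) :=
  (Set.toFinite {S | IsNested 𝒢 S ∧ factors 𝒢 (topFlat M) ⊆ (S : Set (Flat M))}).toFinset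

/-- `𝒩°(M, 𝒢)`: the nested sets that do not contain all factors of `E`. -/
def nestedCirc {E : Type*} [Fintype E] {M : Matroid E} (𝒢 : Set (Flat M)) :
    Finset (Finset (Flat M)) :=
  (Set.toFinite {S | IsNested 𝒢 S ∧ ¬ factors 𝒢 (topFlat M) ⊆ (S : Set (Flat M))}).toFinset

/-- The indicator vector `v_F`. -/
def indVec {E : Type*} {M : Matroid E} (F : Flat M) : E → ℝ := F.1.indicator 1

/-- The cone `σ_S` generated by the vectors `v_F`, `F ∈ S`. -/
def cone {E : Type*} {M : Matroid E} (S : Finset (Flat M)) : Set (E → ℝ) :=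
  {w | ∃ k : Flat M → ℝ, (∀ F, 0 ≤ k F) ∧ w = ∑ F ∈ S, k F • indVec F}

/-- The matroid `M_S = M_w`, for the vector `w = ∑_{F ∈ S} v_F` in the relative interior of `σ_S`.
The theorem includes that every other `w` in the relative interior gives the same matroid. -/
def initialNested {E : Type*} [Fintype E] (M : Matroid E) (S : Finset (Flat M)) : Matroid E :=
  initial M (∑ F ∈ S, indVec F)

/-! ### The rational expressions -/

/-- `q^{-rk F} T^{#F}`. -/
def flatMonomial {E : Type*} {M : Matroid E} (F : Flat M) : ZqT :=
  PowerSeries.C (LaurentPolynomial.T (-(rk M F.1 : ℤ))) * PowerSeries.X ^ F.1.ncard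

/-- `(q - 1) q^{-rk F} T^{#F} / (1 - q^{-rk F} T^{#F})`. -/
def flatFactor {E : Type*} {M : Matroid E} (F : Flat M) : ZqT :=
  PowerSeries.C (LaurentPolynomial.T 1 - 1) *
    (flatMonomial F * PowerSeries.invOfUnit (1 - flatMonomial F) 1)

/-- `invOfUnit` is the genuine inverse of `1 - q^{-rk F} T^{#F}` for every nonempty flat. -/
theorem one_sub_flatMonomial_mul {E : Type*} [Fintype E] {M : Matroid E} (F : Flat M)
    (hF : F.1.Nonempty) :
    (1 - flatMonomial F) * PowerSeries.invOfUnit (1 - flatMonomial F) 1 = 1 := by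
  have h : F.1.ncard ≠ 0 := (Set.ncard_pos (Set.toFinite _)).2 hF |>.ne'
  exact PowerSeries.mul_invOfUnit _ _ (by simp [flatMonomial, h])

/-- `p(q) / (q-1)^{#S} · ∏_{F ∈ S} (q - 1) q^{-rk F} T^{#F} / (1 - q^{-rk F} T^{#F})`, where the
first quotient is that of the polynomial division by the monic polynomial `(q-1)^{#S}`. -/
def nestedTerm {E : Type*} {M : Matroid E} (p : Polynomial ℤ) (S : Finset (Flat M)) : ZqT :=
  PowerSeries.C (p /ₘ (Polynomial.X - 1) ^ S.card).toLaurent * ∏ F ∈ S, flatFactor F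

/-- The rational expression for the motivic zeta function. -/
def nestedZeta {E : Type*} [Fintype E] (M : Matroid E) (𝒢 : Set (Flat M)) : ZqT :=
  PowerSeries.C (LaurentPolynomial.T (-(rank M : ℤ))) *
    ∑ S ∈ nested 𝒢, nestedTerm (charPoly (initialNested M S)) S

/-- The rational expression for the local motivic zeta function. -/
def nestedLocalZeta {E : Type*} [Fintype E] (M : Matroid E) (𝒢 : Set (Flat M)) : ZqT :=
  PowerSeries.C (LaurentPolynomial.T (-(rank M : ℤ))) *
    ∑ S ∈ nestedStar 𝒢, nestedTerm (charPoly (initialNested M S)) S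

/-- The rational expression for the reduced motivic zeta function. -/
def nestedRedZeta {E : Type*} [Fintype E] (M : Matroid E) (𝒢 : Set (Flat M)) : ZqT :=
  PowerSeries.C (LaurentPolynomial.T (-((rank M : ℤ) - 1))) *
    ∑ S ∈ nestedCirc 𝒢, nestedTerm (redCharPoly (initialNested M S)) S

end

end MotivicZeta

namespace MotivicZeta

noncomputable section

set_option linter.unusedSectionVars false

/-! ### The rank function -/

section Rank

variable {E : Type*} [Finite E] {M : Matroid E}

/-! Polynomials `χ` and `χ̄` vanish on a matroid with a loop, so only weights `w` with `M_w`
loopless contribute. If `M` itself has a loop, every `M_w` has it too and both sides of each formula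
are 0; so let `M` be loopless.

If `M_w` is loopless, the superlevel sets of `w` are flats (`isFlat_superlevel`). For `w ≥ 0` this
writes `w` as a sum of indicator vectors of a chain of flats. Each flat is the disjoint union of its
factors, and the factors of a chain form a nested set, so `w` lies in the nested set fan
(`exists_fanPoint_eq`). Its expression as a positive combination of the members of a nested set is
unique (`fanPoint_injOn`).

On the open cone of a nested set `S` everything is explicit. Some base meets every `F ∈ S` in `rk F`
elements (`IsNested.exists_isBase`). Hence `wt` is linear there with value `rk F` on `v_F`, and
`M_w` is the constant matroid `M_S`, whose bases are those with this property. Summing over the cone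
gives a product of geometric series (`prod_geometric`).

Each `F ∈ S` separates `M_S` and has an element lying in no member of `S` other than those above
`F`; splitting off the separators one by one produces the powers of `q - 1`. A point of the fan is
positive everywhere exactly when its nested set contains the factors of `E`, and the remaining
points, those with minimum 0, represent `ℤ^E / ℤ𝟏`. This gives the three formulas at once.

The combinatorial core is `IsNested.factors_joinFlat`, which rests on the additivity of rank over
factors in `IsBuildingSet.factors_spec`. -/

theorem coe_rk (S : Set E) : (rk M S : ℕ∞) = M.eRk S :=
  ENat.natCast_toNat (Matroid.eRk_ne_top_iff.2 (M.isRkFinite_of_finite (Set.toFinite S)))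

theorem rk_mono {S T : Set E} (h : S ⊆ T) : rk M S ≤ rk M T := by
  have := M.eRk_mono h
  rw [← coe_rk, ← coe_rk] at this
  exact_mod_cast this

theorem rk_union_le (S T : Set E) : rk M (S ∪ T) ≤ rk M S + rk M T := by
  have := M.eRk_union_le_eRk_add_eRk S T
  rw [← coe_rk, ← coe_rk, ← coe_rk] at this
  exact_mod_cast this

theorem rk_closure (S : Set E) : rk M (M.closure S) = rk M S := by
  rw [rk, rk, Matroid.eRk_closure_eq]

theorem rk_empty : rk M ∅ = 0 := by simp [rk]

theorem rk_biUnion_le {ι : Type*} (A : Finset ι) (F : ι → Set E) :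
    rk M (⋃ i ∈ A, F i) ≤ ∑ i ∈ A, rk M (F i) := by
  classical
  induction A using Finset.induction_on with
  | empty => simp [rk_empty]
  | insert a A ha ih =>
    rw [Finset.set_biUnion_insert, Finset.sum_insert ha]
    exact (rk_union_le _ _).trans (by omega)

theorem ncard_eq_rk_of_isBasis {I X : Set E} (h : M.IsBasis I X) : I.ncard = rk M X := by
  rw [rk, ← h.encard_eq_eRk, Set.ncard]

theorem ncard_le_rk {I X : Set E} (h : M.Indep I) (hI : I ⊆ X) : I.ncard ≤ rk M X :=
  ENat.toNat_le_toNat (h.encard_le_eRk_of_subset hI)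
    (Matroid.eRk_ne_top_iff.2 (M.isRkFinite_of_finite (Set.toFinite X)))

theorem subset_of_rk_le {F X : Set E} (hF : M.IsFlat F) (hX : X ⊆ M.E) (hFX : F ⊆ X)
    (h : rk M X ≤ rk M F) : X ⊆ F := by
  have h' : M.eRk X ≤ M.eRk F := by
    rw [← coe_rk, ← coe_rk]
    exact_mod_cast h
  have := (M.isRkFinite_of_finite (Set.toFinite F)).closure_eq_closure_of_subset_of_eRk_ge_eRk hFX h'
  rw [← hF.closure, this]
  exact M.subset_closure X hX

theorem rk_lt_of_lt {F G : Flat M} (h : F < G) : rk M F.1 < rk M G.1 := by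
  by_contra hc
  exact h.not_ge (subset_of_rk_le F.2 G.2.subset_ground h.le (not_lt.1 hc))

theorem botFlat_le (F : Flat M) : botFlat M ≤ F := by
  change M.closure ∅ ⊆ F.1
  rw [← F.2.closure]
  exact M.closure_subset_closure (Set.empty_subset _)

theorem rk_botFlat : rk M (botFlat M).1 = 0 := by
  rw [botFlat, rk_closure, rk_empty]

/-- Drop one element from a basis of `F` and take the closure. This is the descent step for
comparing ranks across the isomorphism in the definition of a building set. -/
theorem exists_flat_rk_add_one {F : Flat M} (hF : botFlat M < F) :
    ∃ G : Flat M, G < F ∧ rk M F.1 = rk M G.1 + 1 := by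
  obtain ⟨I, hI⟩ := M.exists_isBasis F.1 F.2.subset_ground
  have hIF : M.closure I = F.1 := by rw [hI.closure_eq_closure, F.2.closure]
  obtain ⟨e, he⟩ : I.Nonempty := by
    rw [Set.nonempty_iff_ne_empty]
    rintro rfl
    exact hF.ne (Subtype.ext hIF)
  have hlt : M.closure (I \ {e}) ⊂ M.closure I := hI.indep.closure_sdiff_singleton_ssubset he
  refine ⟨⟨M.closure (I \ {e}), M.isFlat_closure _⟩, ?_, ?_⟩
  · rw [hIF] at hlt
    exact lt_iff_le_not_ge.2 hlt
  · change rk M F.1 = rk M (M.closure (I \ {e})) + 1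
    rw [rk_closure, ← ncard_eq_rk_of_isBasis hI,
      ← ncard_eq_rk_of_isBasis (hI.indep.subset Set.sdiff_subset).isBasis_self,
      Set.ncard_sdiff_singleton_add_one he]

theorem subset_joinFlat {A : Finset (Flat M)} {F : Flat M} (hF : F ∈ A) : F ≤ joinFlat M A := by
  change F.1 ⊆ M.closure (⋃ F ∈ A, F.1)
  refine (Set.subset_biUnion_of_mem (u := fun F : Flat M => F.1) (Finset.mem_coe.2 hF)).trans
    (M.subset_closure _ ?_)
  exact Set.iUnion₂_subset fun F _ => F.2.subset_ground

theorem joinFlat_le {A : Finset (Flat M)} {X : Flat M} (h : ∀ F ∈ A, F ≤ X) :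
    joinFlat M A ≤ X := by
  change M.closure (⋃ F ∈ A, F.1) ⊆ X.1
  rw [← X.2.closure]
  exact M.closure_subset_closure (Set.iUnion₂_subset fun F hF => h F hF)

theorem joinFlat_singleton (F : Flat M) : joinFlat M {F} = F := by
  apply Subtype.ext
  simp [joinFlat, F.2.closure]

end Rank

/-! ### Factors of a flat -/

section Factors

variable {E : Type*} [Finite E] {M : Matroid E} {𝒢 : Set (Flat M)}

theorem mem_factors {G X : Flat M} : G ∈ factors 𝒢 X ↔ Maximal (fun H => H ∈ 𝒢 ∧ H ≤ X) G :=
  Iff.rfl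

theorem mem_of_mem_factors {G X : Flat M} (h : G ∈ factors 𝒢 X) : G ∈ 𝒢 := (mem_factors.1 h).prop.1

theorem le_of_mem_factors {G X : Flat M} (h : G ∈ factors 𝒢 X) : G ≤ X := (mem_factors.1 h).prop.2

theorem eq_of_mem_factors {G H X : Flat M} (h : G ∈ factors 𝒢 X) (hH : H ∈ 𝒢) (hHX : H ≤ X)
    (hGH : G ≤ H) : G = H :=
  le_antisymm hGH ((mem_factors.1 h).le_of_ge ⟨hH, hHX⟩ hGH)

theorem exists_le_factor {G X : Flat M} (hG : G ∈ 𝒢) (hGX : G ≤ X) : ∃ H ∈ factors 𝒢 X, G ≤ H := by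
  obtain ⟨H, hGH, hH⟩ := (Set.toFinite {H : Flat M | H ∈ 𝒢 ∧ H ≤ X}).exists_le_maximal
    (a := G) ⟨hG, hGX⟩
  exact ⟨H, hH, hGH⟩

theorem factors_of_mem {G : Flat M} (hG : G ∈ 𝒢) : factors 𝒢 G = {G} := by
  ext H
  constructor
  · intro hH
    exact eq_of_mem_factors hH hG le_rfl (le_of_mem_factors hH)
  · rintro rfl
    exact ⟨⟨hG, le_rfl⟩, fun K hK _ => hK.2⟩

/-- The factors of a flat `X` cover it, meet pairwise in loops, and have ranks that add up to the
rank of `X`. -/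
theorem IsBuildingSet.factors_spec (h𝒢 : IsBuildingSet M 𝒢) {X : Flat M} (hX : botFlat M < X) :
    (∀ e ∈ X.1, ∃ G ∈ factors 𝒢 X, e ∈ G.1) ∧
    (∀ G ∈ factors 𝒢 X, ∀ H ∈ factors 𝒢 X, G ≠ H → G.1 ∩ H.1 ⊆ M.closure ∅) ∧
    ∀ A : Finset (Flat M), (A : Set (Flat M)) = factors 𝒢 X →
      rk M X.1 = ∑ G ∈ A, rk M G.1 := by
  classical
  obtain ⟨φ, hφ⟩ := h𝒢.2 X hX
  -- `b` and `t` are the least and greatest tuples; `Function.update b G (t G)` is the tuple that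
  -- `φ` must send to `G`.
  let b : (G : factors 𝒢 X) → Set.Icc (botFlat M) G.1 := fun G => ⟨botFlat M, le_rfl, botFlat_le _⟩
  let t : (G : factors 𝒢 X) → Set.Icc (botFlat M) G.1 := fun G => ⟨G.1, botFlat_le _, le_rfl⟩
  have hb : ∀ x, b ≤ x := fun x G => (x G).2.1
  have hφb : (φ b).1 = botFlat M := by
    have : φ b ≤ ⟨botFlat M, le_rfl, hX.le⟩ := by
      rw [← φ.le_symm_apply]
      exact hb _
    exact le_antisymm this (φ b).2.1
  have hφG : ∀ G : factors 𝒢 X, (φ (Function.update b G (t G))).1 = G.1 := fun G =>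
    hφ G _ (by simp [t]) fun H hH => by simp [Function.update_of_ne hH, b]
  have hxb : ∀ x, x ≠ b → ∃ G, botFlat M < (x G).1 := by
    intro x hx
    obtain ⟨G, hG⟩ := Function.ne_iff.1 hx
    exact ⟨G, lt_of_le_of_ne (x G).2.1 fun h => hG (Subtype.ext h.symm)⟩
  have hcover : ∀ e ∈ X.1, ∃ G ∈ factors 𝒢 X, e ∈ G.1 := by
    intro e he
    by_cases hel : e ∈ M.closure ∅
    -- A loop lies in every flat, so it is enough that some factor exists; without one, `t = b` and
    -- `X` would be the bottom flat.
    · have : t ≠ b := by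
        intro h
        have h1 : (φ t).1 = botFlat M := h ▸ hφb
        have h2 : (⟨X, hX.le, le_rfl⟩ : Set.Icc (botFlat M) X) ≤ φ t := by
          rw [← φ.symm_apply_le]
          exact fun G => (φ.symm _ G).2.2
        exact hX.not_ge (h1 ▸ h2)
      obtain ⟨G, -⟩ := hxb t this
      exact ⟨G.1, G.2, botFlat_le G.1 hel⟩
    · have heE : e ∈ M.E := X.2.subset_ground he
      -- Pull the rank-one flat `cl {e}` back to a tuple `x`, and keep only one nontrivial
      -- coordinate `G` of it. The image of that tuple is above the bottom and below both `cl {e}`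
      -- and `G`, so `G` contains a nonloop parallel to `e`.
      let C : Flat M := ⟨M.closure {e}, M.isFlat_closure _⟩
      have heC : e ∈ C.1 := M.mem_closure_self e heE
      have hCX : C ≤ X := by
        change M.closure {e} ⊆ X.1
        rw [← X.2.closure]
        exact M.closure_subset_closure (Set.singleton_subset_iff.2 he)
      obtain ⟨x, hx⟩ := φ.surjective ⟨C, botFlat_le C, hCX⟩
      have hx' : (φ x).1 = C := by rw [hx]
      have hxne : x ≠ b := by
        rintro rfl
        rw [hφb] at hx'
        exact hel (by simpa [botFlat, ← hx'] using heC)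
      obtain ⟨G, hG⟩ := hxb x hxne
      refine ⟨G.1, G.2, ?_⟩
      let y := Function.update b G (x G)
      have hyx : y ≤ x := by
        intro H
        by_cases h : H = G
        · subst h; simp [y]
        · simp only [y, Function.update_of_ne h]; exact hb x H
      have hyt : y ≤ Function.update b G (t G) := by
        intro H
        by_cases h : H = G
        · subst h
          simp only [y, Function.update_self]
          exact (x H).2.2
        · simp only [y, Function.update_of_ne h]; exact le_rfl
      have h1 : (φ y).1 ≤ C := hx' ▸ (φ.monotone hyx : (φ y) ≤ φ x)
      have h2 : (φ y).1 ≤ G.1 := hφG G ▸ (φ.monotone hyt : (φ y) ≤ _)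
      have h3 : botFlat M < (φ y).1 := by
        refine lt_of_le_of_ne (φ y).2.1 fun h => ?_
        have : φ y = φ b := Subtype.ext (h.symm.trans hφb.symm)
        have h4 := congrFun (φ.injective this) G
        simp only [y, Function.update_self] at h4
        rw [h4] at hG
        exact hG.ne rfl
      obtain ⟨f, hf, hfl⟩ : ∃ f ∈ (φ y).1.1, f ∉ M.closure ∅ :=
        Set.not_subset.1 fun h => h3.not_ge h
      have hef : e ∈ M.closure {f} := by
        have hf' : f ∈ M.closure (insert e ∅) := by simpa using h1 hf
        have := M.mem_closure_insert hfl hf'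
        simpa using this
      have : M.closure {f} ⊆ G.1.1 := by
        rw [← G.1.2.closure]
        exact M.closure_subset_closure (Set.singleton_subset_iff.2 (h2 hf))
      exact this hef
  refine ⟨hcover, ?_, ?_⟩
  · intro G hG H hH hGH
    let G' : factors 𝒢 X := ⟨G, hG⟩
    let H' : factors 𝒢 X := ⟨H, hH⟩
    have hne : G' ≠ H' := fun h => hGH (congrArg Subtype.val h)
    -- The preimage of the intersection lies below tuples supported at two different coordinates, so
    -- it is `b`.
    let K : Flat M := ⟨G.1 ∩ H.1, by
      rw [Set.inter_eq_iInter]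
      exact Matroid.IsFlat.iInter fun b => by cases b <;> simp [G.2, H.2]⟩
    have hKX : K ≤ X := (Set.inter_subset_left : K.1 ⊆ G.1).trans (le_of_mem_factors hG)
    obtain ⟨x, hx⟩ := φ.surjective ⟨K, botFlat_le K, hKX⟩
    have hx' : (φ x).1 = K := by rw [hx]
    have h1 : x ≤ Function.update b G' (t G') := by
      rw [← φ.le_iff_le]
      change (φ x).1 ≤ (φ (Function.update b G' (t G'))).1
      rw [hφG, hx']
      exact Set.inter_subset_left
    have h2 : x ≤ Function.update b H' (t H') := by
      rw [← φ.le_iff_le]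
      change (φ x).1 ≤ (φ (Function.update b H' (t H'))).1
      rw [hφG, hx']
      exact Set.inter_subset_right
    have h3 : x ≤ b := by
      intro J
      by_cases h : J = G'
      · subst h
        simpa [Function.update_of_ne hne] using h2 G'
      · simpa [Function.update_of_ne h] using h1 J
    have h4 : x = b := le_antisymm h3 (hb x)
    have : K = botFlat M := by rw [← hx', h4, hφb]
    exact (congrArg Subtype.val this).subset
  · intro A hA
    apply le_antisymm
    · have hXA : X.1 ⊆ ⋃ G ∈ A, G.1 := by
        intro e he
        obtain ⟨G, hG, heG⟩ := hcover e he
        exact Set.mem_biUnion (Finset.mem_coe.1 (hA ▸ hG : G ∈ (A : Set (Flat M)))) heG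
      exact (rk_mono hXA).trans (rk_biUnion_le A _)
    · have : Fintype (factors 𝒢 X) := Fintype.ofFinite _
      -- Lowering one coordinate of `x` by one in rank strictly lowers `φ x`, so the rank of `φ x`
      -- is at least the sum of the ranks of the coordinates.
      have key : ∀ n : ℕ, ∀ x, ∑ G, rk M (x G).1.1 = n → n ≤ rk M (φ x).1.1 := by
        intro n
        induction n with
        | zero => intro x _; exact Nat.zero_le _
        | succ n ih =>
          intro x hx
          have hxne : x ≠ b := by
            rintro rfl
            simp [b, rk_botFlat] at hx
          obtain ⟨G, hG⟩ := hxb x hxne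
          obtain ⟨F, hF, hFr⟩ := exists_flat_rk_add_one hG
          let y := Function.update x G ⟨F, botFlat_le F, hF.le.trans (x G).2.2⟩
          have hyx : y < x := by
            refine lt_of_le_of_ne (update_le_self_iff.2 hF.le) fun h => ?_
            have := congrFun h G
            simp only [y, Function.update_self] at this
            exact hF.ne (congrArg Subtype.val this)
          have hlt : (φ y).1 < (φ x).1 := φ.strictMono hyx
          have := rk_lt_of_lt hlt
          have hs : ∑ H, rk M (y H).1.1 = n := by
            rw [← Finset.add_sum_erase _ _ (Finset.mem_univ G)] at hx ⊢
            have : ∑ H ∈ Finset.univ.erase G, rk M (y H).1.1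
                = ∑ H ∈ Finset.univ.erase G, rk M (x H).1.1 :=
              Finset.sum_congr rfl fun H hH => by
                simp only [y, Function.update_of_ne (Finset.ne_of_mem_erase hH)]
            rw [this]
            simp only [y, Function.update_self]
            omega
          have := ih y hs
          omega
      have h1 := key _ t rfl
      have h2 : rk M (φ t).1.1 ≤ rk M X.1 := rk_mono (φ t).2.2
      refine le_trans (le_of_eq ?_) (h1.trans h2)
      exact Finset.sum_subtype A (fun G => by rw [← hA, Finset.mem_coe]) fun G => rk M G.1

/-- An antichain in a nested set consists of the factors of its join. -/
theorem IsNested.factors_joinFlat (h𝒢 : IsBuildingSet M 𝒢) {S A : Finset (Flat M)}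
    (hS : IsNested 𝒢 S) (hA : A ⊆ S) (hanti : IsAntichain (· ≤ ·) (A : Set (Flat M)))
    (hne : A.Nonempty) : factors 𝒢 (joinFlat M A) = A ∧ botFlat M < joinFlat M A := by
  classical
  have hbot : botFlat M < joinFlat M A := by
    obtain ⟨F, hF⟩ := hne
    exact (h𝒢.1 F (hS.1 F (hA hF))).trans_le (subset_joinFlat hF)
  refine ⟨?_, hbot⟩
  set X := joinFlat M A with hXdef
  obtain ⟨-, -, hrk⟩ := h𝒢.factors_spec hbot
  let Φ : Finset (Flat M) := (Set.toFinite (factors 𝒢 X)).toFinset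
  have hΦ : ∀ G, G ∈ Φ ↔ G ∈ factors 𝒢 X := fun G => by simp [Φ]
  have hrk' := hrk Φ (by simp [Φ])
  -- `B G` collects the members of `A` below the factor `G`. These groups exhaust `A`, so the ranks
  -- of their joins add up to at least `rk X`.
  let B : Flat M → Finset (Flat M) := fun G => A.filter (· ≤ G)
  have hBG : ∀ G, joinFlat M (B G) ≤ G := fun G =>
    joinFlat_le fun F hF => (Finset.mem_filter.1 hF).2
  have hcov : ⋃ F ∈ A, F.1 ⊆ ⋃ G ∈ Φ, (joinFlat M (B G)).1 := by
    refine Set.iUnion₂_subset fun F hF => ?_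
    obtain ⟨G, hG, hFG⟩ := exists_le_factor (hS.1 F (hA hF)) (subset_joinFlat hF)
    refine Set.Subset.trans ?_ (Set.subset_biUnion_of_mem
      (u := fun G => (joinFlat M (B G)).1) (Finset.mem_coe.2 ((hΦ G).2 hG)))
    exact subset_joinFlat (Finset.mem_filter.2 ⟨hF, hFG⟩)
  have hle : rk M X.1 ≤ ∑ G ∈ Φ, rk M (joinFlat M (B G)).1 := by
    rw [hXdef, joinFlat, rk_closure]
    exact (rk_mono hcov).trans (rk_biUnion_le _ _)
  -- The ranks of the factors add up to exactly `rk X`, so no factor can exceed the join of its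
  -- group.
  have heq : ∀ G ∈ Φ, joinFlat M (B G) = G := by
    have h1 : ∀ G ∈ Φ, rk M (joinFlat M (B G)).1 ≤ rk M G.1 := fun G _ => rk_mono (hBG G)
    have h2 := (Finset.sum_eq_sum_iff_of_le h1).1
      (le_antisymm (Finset.sum_le_sum h1) (hrk' ▸ hle))
    intro G hG
    exact le_antisymm (hBG G)
      (subset_of_rk_le (joinFlat M (B G)).2 G.2.subset_ground (hBG G) (h2 G hG).ge)
  have hsing : ∀ G ∈ Φ, G ∈ A ∧ ∀ F ∈ A, F ≤ G → F = G := by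
    intro G hG
    have hG𝒢 : G ∈ 𝒢 := mem_of_mem_factors ((hΦ G).1 hG)
    -- As `G ∈ 𝒢` is the join of `B G`, nestedness allows at most one element there; an empty group
    -- would make `G` the bottom flat.
    have hcard : (B G).card < 2 := by
      by_contra hc
      refine hS.2 (B G) ((Finset.filter_subset _ _).trans hA) (not_lt.1 hc)
        (hanti.subset (Finset.coe_subset.2 (Finset.filter_subset _ _))) ?_
      rwa [heq G hG]
    have hpos : (B G).Nonempty := by
      rw [Finset.nonempty_iff_ne_empty]
      intro h0
      have := heq G hG
      rw [h0] at this
      have hbG := h𝒢.1 G hG𝒢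
      rw [← this] at hbG
      exact hbG.ne (Subtype.ext (by simp [joinFlat, botFlat]))
    obtain ⟨F, hF⟩ : ∃ F, B G = {F} := Finset.card_eq_one.1 (by have := hpos.card_pos; omega)
    have hFG : F = G := by
      rw [← heq G hG, hF, joinFlat_singleton]
    rw [hFG] at hF
    refine ⟨(Finset.mem_filter.1 (hF ▸ Finset.mem_singleton_self G : G ∈ B G)).1, ?_⟩
    intro F' hF' hle
    have : F' ∈ B G := Finset.mem_filter.2 ⟨hF', hle⟩
    rw [hF] at this
    exact Finset.mem_singleton.1 this
  ext G
  constructor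
  · intro hG
    exact (hsing G ((hΦ G).2 hG)).1
  · intro hG
    obtain ⟨H, hH, hGH⟩ := exists_le_factor (hS.1 G (hA hG)) (subset_joinFlat hG)
    rw [(hsing H ((hΦ H).2 hH)).2 G hG hGH]
    exact hH

end Factors

/-! ### Bases adapted to a nested set -/

section Adapted

variable {E : Type*} [Finite E] {M : Matroid E} {𝒢 : Set (Flat M)}

theorem IsNested.mono {S T : Finset (Flat M)} (hS : IsNested 𝒢 S) (h : T ⊆ S) : IsNested 𝒢 T :=
  ⟨fun F hF => hS.1 F (h hF), fun A hA => hS.2 A (hA.trans h)⟩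

open Classical in
/-- The maximal elements of a finite set of flats. -/
def maximals (S : Finset (Flat M)) : Finset (Flat M) := S.filter (Maximal (· ∈ S))

theorem mem_maximals {S : Finset (Flat M)} {F : Flat M} :
    F ∈ maximals S ↔ Maximal (· ∈ S) F := by
  classical
  simp only [maximals, Finset.mem_filter, and_iff_right_iff_imp]
  exact fun h => h.prop

theorem maximals_subset (S : Finset (Flat M)) : maximals S ⊆ S := fun _ hF =>
  (mem_maximals.1 hF).prop

theorem isAntichain_maximals (S : Finset (Flat M)) :
    IsAntichain (· ≤ ·) (maximals S : Set (Flat M)) := by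
  intro F hF G hG hne hle
  exact hne ((mem_maximals.1 hF).eq_of_le (mem_maximals.1 hG).prop hle)

theorem exists_le_maximals {S : Finset (Flat M)} {F : Flat M} (hF : F ∈ S) :
    ∃ G ∈ maximals S, F ≤ G := by
  obtain ⟨G, hFG, hG⟩ := S.exists_le_maximal hF
  exact ⟨G, mem_maximals.2 hG, hFG⟩

theorem maximals_nonempty {S : Finset (Flat M)} (hS : S.Nonempty) : (maximals S).Nonempty := by
  obtain ⟨F, hF⟩ := hS
  obtain ⟨G, hG, -⟩ := exists_le_maximals hF
  exact ⟨G, hG⟩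

theorem iUnion_maximals (S : Finset (Flat M)) : ⋃ F ∈ maximals S, F.1 = ⋃ F ∈ S, F.1 := by
  apply Set.Subset.antisymm
  · exact Set.biUnion_subset_biUnion_left (maximals_subset S)
  · refine Set.iUnion₂_subset fun F hF => ?_
    obtain ⟨G, hG, hFG⟩ := exists_le_maximals hF
    exact Set.Subset.trans hFG (Set.subset_biUnion_of_mem (u := fun F : Flat M => F.1) hG)

theorem IsNested.factors_join_maximals (h𝒢 : IsBuildingSet M 𝒢) {S : Finset (Flat M)}
    (hS : IsNested 𝒢 S) (hne : S.Nonempty) :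
    factors 𝒢 (joinFlat M (maximals S)) = maximals S ∧ botFlat M < joinFlat M (maximals S) :=
  hS.factors_joinFlat h𝒢 (maximals_subset S) (isAntichain_maximals S) (maximals_nonempty hne)

/-- The maximal members are the factors of their join, and factors cover their flat. Thus the union
of a nonempty nested set is already closed. -/
theorem IsNested.join_maximals (h𝒢 : IsBuildingSet M 𝒢) {S : Finset (Flat M)}
    (hS : IsNested 𝒢 S) (hne : S.Nonempty) :
    (joinFlat M (maximals S)).1 = ⋃ F ∈ S, F.1 := by
  obtain ⟨h1, h2⟩ := hS.factors_join_maximals h𝒢 hne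
  rw [← iUnion_maximals]
  apply Set.Subset.antisymm
  · intro e he
    obtain ⟨G, hG, heG⟩ := (h𝒢.factors_spec h2).1 e he
    rw [h1] at hG
    exact Set.mem_biUnion (Finset.mem_coe.1 hG) heG
  · exact Set.iUnion₂_subset fun F hF => subset_joinFlat hF

theorem IsNested.rk_iUnion (h𝒢 : IsBuildingSet M 𝒢) {S : Finset (Flat M)} (hS : IsNested 𝒢 S) :
    rk M (⋃ F ∈ S, F.1) = ∑ F ∈ maximals S, rk M F.1 := by
  rcases S.eq_empty_or_nonempty with rfl | hne
  · have : maximals (∅ : Finset (Flat M)) = ∅ := Finset.subset_empty.1 (maximals_subset _)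
    simp [this, rk_empty]
  · obtain ⟨h1, h2⟩ := hS.factors_join_maximals h𝒢 hne
    rw [← hS.join_maximals h𝒢 hne]
    exact (h𝒢.factors_spec h2).2.2 _ h1.symm

theorem ncard_biUnion_le {ι : Type*} (A : Finset ι) (F : ι → Set E) :
    (⋃ i ∈ A, F i).ncard ≤ ∑ i ∈ A, (F i).ncard := by
  classical
  induction A using Finset.induction_on with
  | empty => simp
  | insert a A ha ih =>
    rw [Finset.set_biUnion_insert, Finset.sum_insert ha]
    exact (Set.ncard_union_le _ _).trans (by omega)

/-- Remove a maximal `F`, solve the problem for the rest, and extend the solution to a basis of the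
whole union. Additivity of rank over the maximal members forces the right count on each of them, `F`
included; the other counts were maximal before and cannot drop. -/
theorem IsNested.exists_indep (h𝒢 : IsBuildingSet M 𝒢) {S : Finset (Flat M)}
    (hS : IsNested 𝒢 S) : ∃ I, M.Indep I ∧ ∀ F ∈ S, (I ∩ F.1).ncard = rk M F.1 := by
  classical
  -- Containment in the union is carried along so that the extension to a basis of the larger union
  -- is possible.
  suffices h : ∃ I, M.Indep I ∧ I ⊆ ⋃ F ∈ S, F.1 ∧ ∀ F ∈ S, (I ∩ F.1).ncard = rk M F.1 by
    obtain ⟨I, h1, -, h2⟩ := h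
    exact ⟨I, h1, h2⟩
  induction S using Finset.strongInduction with
  | H S ih =>
    rcases S.eq_empty_or_nonempty with rfl | hne
    · exact ⟨∅, M.empty_indep, Set.empty_subset _, by simp⟩
    obtain ⟨F, hF⟩ := maximals_nonempty hne
    have hFS := maximals_subset S hF
    obtain ⟨I', hI', hI's, hI'r⟩ := ih (S.erase F) (Finset.erase_ssubset hFS)
      (hS.mono (Finset.erase_subset _ _))
    have hsub : I' ⊆ ⋃ F ∈ S, F.1 :=
      hI's.trans (Set.biUnion_subset_biUnion_left (Finset.erase_subset F S))
    obtain ⟨I, hI, hI'I⟩ := hI'.subset_isBasis_of_subset hsub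
      (Set.iUnion₂_subset fun F _ => F.2.subset_ground)
    refine ⟨I, hI.indep, hI.subset, fun G hG => ?_⟩
    have hle : ∀ G ∈ maximals S, (I ∩ G.1).ncard ≤ rk M G.1 := fun G _ =>
      ncard_le_rk (hI.indep.subset Set.inter_subset_left) Set.inter_subset_right
    have hcov : I = ⋃ G ∈ maximals S, I ∩ G.1 := by
      rw [← Set.inter_iUnion₂, iUnion_maximals, Set.inter_eq_left.2 hI.subset]
    have hsum : ∑ G ∈ maximals S, rk M G.1 ≤ ∑ G ∈ maximals S, (I ∩ G.1).ncard := by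
      rw [← hS.rk_iUnion h𝒢, ← ncard_eq_rk_of_isBasis hI]
      conv_lhs => rw [hcov]
      exact ncard_biUnion_le _ _
    have heq := (Finset.sum_eq_sum_iff_of_le hle).1 (le_antisymm (Finset.sum_le_sum hle) hsum)
    by_cases hGF : G = F
    · subst hGF
      exact heq G hF
    · refine le_antisymm
        (ncard_le_rk (hI.indep.subset Set.inter_subset_left) Set.inter_subset_right) ?_
      rw [← hI'r G (Finset.mem_erase.2 ⟨hGF, hG⟩)]
      exact Set.ncard_le_ncard (Set.inter_subset_inter_left _ hI'I) (Set.toFinite _)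

theorem IsNested.exists_isBase (h𝒢 : IsBuildingSet M 𝒢) {S : Finset (Flat M)}
    (hS : IsNested 𝒢 S) : ∃ B, M.IsBase B ∧ ∀ F ∈ S, (B ∩ F.1).ncard = rk M F.1 := by
  obtain ⟨I, hI, hIr⟩ := hS.exists_indep h𝒢
  obtain ⟨B, hB, hIB⟩ := hI.exists_isBase_superset
  refine ⟨B, hB, fun F hF => le_antisymm
    (ncard_le_rk (hB.indep.subset Set.inter_subset_left) Set.inter_subset_right) ?_⟩
  rw [← hIr F hF]
  exact Set.ncard_le_ncard (Set.inter_subset_inter_left _ hIB) (Set.toFinite _)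

end Adapted

/-! ### Weights in the cone of a nested set -/

section Weights

variable {E : Type*} [Fintype E] {M : Matroid E} {𝒢 : Set (Flat M)}

theorem initial_isBase {R : Type*} [AddCommGroup R] [LinearOrder R] [IsOrderedAddMonoid R]
    {w : E → R} {B : Set E} :
    (initial M w).IsBase B ↔ M.IsBase B ∧ setWeight w B = wt M w := Iff.rfl

variable {R : Type*} [CommRing R] [LinearOrder R] [IsStrictOrderedRing R]

/-- The vector `∑_{F ∈ S} k_F v_F`. -/
def flatSum (k : Flat M → R) (S : Finset (Flat M)) : E → R :=
  ∑ F ∈ S, k F • F.1.indicator 1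

theorem flatSum_apply (k : Flat M → R) (S : Finset (Flat M)) (e : E) :
    flatSum k S e = ∑ F ∈ S, F.1.indicator (fun _ => k F) e := by
  classical
  simp [flatSum, Finset.sum_apply, Set.indicator_apply]

theorem sum_indicator_const (B : Set E) (c : R) : ∑ e, B.indicator (fun _ => c) e = B.ncard * c := by
  classical
  rw [Finset.sum_indicator_eq_sum_filter]
  simp [Set.ncard_eq_toFinset_card', Set.toFinset]

theorem setWeight_flatSum (k : Flat M → R) (S : Finset (Flat M)) (B : Set E) :
    setWeight (flatSum k S) B = ∑ F ∈ S, (B ∩ F.1).ncard * k F := by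
  classical
  simp_rw [← sum_indicator_const]
  rw [Finset.sum_comm, setWeight]
  refine Finset.sum_congr rfl fun e _ => ?_
  by_cases he : e ∈ B <;> simp [Set.indicator_apply, flatSum_apply, he]

/-- Every base satisfies `#(B ∩ F) ≤ rk F` for each `F`, and an adapted base attains all these
bounds simultaneously. -/
theorem IsNested.wt_flatSum (h𝒢 : IsBuildingSet M 𝒢) {S : Finset (Flat M)} (hS : IsNested 𝒢 S)
    {k : Flat M → R} (hk : ∀ F ∈ S, 0 < k F) :
    wt M (flatSum k S) = ∑ F ∈ S, (rk M F.1 : R) * k F := by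
  apply le_antisymm
  · refine Finset.sup'_le _ _ fun B hB => ?_
    rw [setWeight_flatSum]
    refine Finset.sum_le_sum fun F hF => mul_le_mul_of_nonneg_right ?_ (hk F hF).le
    exact_mod_cast ncard_le_rk ((mem_bases.1 hB).indep.subset Set.inter_subset_left)
      Set.inter_subset_right
  · obtain ⟨B, hB, hBr⟩ := hS.exists_isBase h𝒢
    have := setWeight_le_wt (flatSum k S) hB
    rw [setWeight_flatSum] at this
    rwa [Finset.sum_congr rfl fun F hF => by rw [hBr F hF]] at this

/-- Maximal weight means equality in every termwise bound, a condition in which the positive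
coefficients `k` no longer appear. -/
theorem IsNested.initial_flatSum_isBase (h𝒢 : IsBuildingSet M 𝒢) {S : Finset (Flat M)}
    (hS : IsNested 𝒢 S) {k : Flat M → R} (hk : ∀ F ∈ S, 0 < k F) {B : Set E} :
    (initial M (flatSum k S)).IsBase B ↔
      M.IsBase B ∧ ∀ F ∈ S, (B ∩ F.1).ncard = rk M F.1 := by
  rw [initial_isBase, hS.wt_flatSum h𝒢 hk, setWeight_flatSum]
  refine and_congr_right fun hB => ?_
  rw [Finset.sum_eq_sum_iff_of_le]
  · refine forall₂_congr fun F hF => ?_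
    rw [mul_left_inj' (hk F hF).ne', Nat.cast_inj]
  · refine fun F hF => mul_le_mul_of_nonneg_right ?_ (hk F hF).le
    exact_mod_cast ncard_le_rk (hB.indep.subset Set.inter_subset_left) Set.inter_subset_right

theorem initialNested_eq (S : Finset (Flat M)) :
    initialNested M S = initial M (flatSum (fun _ => (1 : ℝ)) S) := by
  simp [initialNested, flatSum, indVec]

theorem IsNested.initialNested_isBase (h𝒢 : IsBuildingSet M 𝒢) {S : Finset (Flat M)}
    (hS : IsNested 𝒢 S) {B : Set E} :
    (initialNested M S).IsBase B ↔ M.IsBase B ∧ ∀ F ∈ S, (B ∩ F.1).ncard = rk M F.1 := by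
  rw [initialNested_eq]
  exact hS.initial_flatSum_isBase h𝒢 fun _ _ => one_pos

/-- Generality in `R` is used twice: real weights show that `M_S` is well defined, integer weights
evaluate the zeta functions. -/
theorem IsNested.initial_flatSum (h𝒢 : IsBuildingSet M 𝒢) {S : Finset (Flat M)}
    (hS : IsNested 𝒢 S) {k : Flat M → R} (hk : ∀ F ∈ S, 0 < k F) :
    initial M (flatSum k S) = initialNested M S :=
  Matroid.ext_isBase rfl fun B _ => by
    rw [hS.initial_flatSum_isBase h𝒢 hk, hS.initialNested_isBase h𝒢]

/-- A point in the relative interior of `σ_S` is a positive combination of the generators. -/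
theorem exists_pos_of_mem_intrinsicInterior {S : Finset (Flat M)} {w : E → ℝ}
    (hw : w ∈ intrinsicInterior ℝ (cone S)) :
    ∃ k : Flat M → ℝ, (∀ F ∈ S, 0 < k F) ∧ w = flatSum k S := by
  obtain ⟨y, hy, rfl⟩ := mem_intrinsicInterior.1 hw
  have hp : ∑ F ∈ S, indVec F ∈ cone S := ⟨fun _ => 1, fun _ => zero_le_one, by simp⟩
  let p : affineSpan ℝ (cone S) := ⟨_, subset_affineSpan ℝ _ hp⟩
  -- Continue the line from `p = ∑ v_F` to `y` slightly past `y`, staying in the cone. Then `(1 + δ)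
  -- y = γ(-δ) + δ p`, and the term `δ p` makes all coefficients positive.
  let γ : ℝ → affineSpan ℝ (cone S) := fun t => ⟨AffineMap.lineMap y.1 p.1 t,
    AffineMap.lineMap_mem t y.2 p.2⟩
  have hγ : Continuous γ := by
    refine Continuous.subtype_mk ?_ _
    exact AffineMap.lineMap_continuous
  have h0 : γ 0 = y := Subtype.ext (by simp [γ])
  have hnear : ∀ᶠ t in nhds (0 : ℝ), γ t ∈ ((↑) ⁻¹' cone S : Set (affineSpan ℝ (cone S))) := by
    have := hγ.continuousAt (x := 0)
    rw [ContinuousAt, h0] at this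
    exact this.eventually (mem_interior_iff_mem_nhds.1 hy)
  obtain ⟨ε, hε, hball⟩ := Metric.eventually_nhds_iff.1 hnear
  obtain ⟨k, hk, hkw⟩ : γ (-(ε / 2)) ∈ ((↑) ⁻¹' cone S : Set (affineSpan ℝ (cone S))) :=
    hball (by rw [Real.dist_eq, sub_zero, abs_neg, abs_of_pos (half_pos hε)]; linarith)
  set δ := ε / 2 with hδ
  have hδ0 : 0 < δ := half_pos hε
  refine ⟨fun F => (1 + δ)⁻¹ * (k F + δ), fun F _ => ?_, ?_⟩
  · have := hk F
    positivity
  · have h1 : (1 + δ) • y.1 = ∑ F ∈ S, (k F + δ) • indVec F := by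
      simp_rw [add_smul, Finset.sum_add_distrib, ← Finset.smul_sum]
      rw [← hkw]
      simp only [γ, p, AffineMap.lineMap_apply_module]
      module
    have h2 : y.1 = (1 + δ)⁻¹ • ((1 + δ) • y.1) := by
      rw [smul_smul, inv_mul_cancel₀ (by positivity), one_smul]
    rw [h2, h1, flatSum, Finset.smul_sum]
    refine Finset.sum_congr rfl fun F _ => ?_
    rw [smul_smul, indVec]

end Weights

/-! ### Separators and divisibility -/

section Separators

variable {E : Type*} [Finite E] {N : Matroid E}

theorem rk_submod (S T : Set E) : rk N (S ∩ T) + rk N (S ∪ T) ≤ rk N S + rk N T := by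
  have := N.eRk_inter_add_eRk_union_le S T
  rw [← coe_rk, ← coe_rk, ← coe_rk, ← coe_rk] at this
  exact_mod_cast this

theorem ncard_eq_rank {B : Set E} (hB : N.IsBase B) : B.ncard = rank N := by
  rw [rank, rk, ← Matroid.eRank_def, ← hB.encard_eq_eRank, Set.ncard]

theorem exists_isBase_ncard_inter (hN : N.E = Set.univ) (F : Set E) :
    ∃ B, N.IsBase B ∧ (B ∩ F).ncard = rk N F := by
  obtain ⟨I, hI⟩ := N.exists_isBasis F (hN ▸ Set.subset_univ F)
  obtain ⟨B, hB, hIB⟩ := hI.indep.exists_isBase_superset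
  refine ⟨B, hB, le_antisymm
    (ncard_le_rk (hB.indep.subset Set.inter_subset_left) Set.inter_subset_right) ?_⟩
  rw [← ncard_eq_rk_of_isBasis hI]
  exact Set.ncard_le_ncard (Set.subset_inter hIB hI.subset) (Set.toFinite _)

/-- If every base meets `F` in the same number of elements, then `F` is a separator. -/
theorem rk_eq_add_of_ncard_inter (hN : N.E = Set.univ) {F : Set E} {c : ℕ}
    (h : ∀ B, N.IsBase B → (B ∩ F).ncard = c) (T : Set E) :
    rk N T = rk N (T ∩ F) + rk N (T \ F) := by
  obtain ⟨B, hB, hBF⟩ := exists_isBase_ncard_inter hN F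
  obtain ⟨B', hB', hBF'⟩ := exists_isBase_ncard_inter hN Fᶜ
  -- `B` realises the rank of `F` and `B'` that of its complement. Both meet `F` in `c` elements, so
  -- the two ranks add up to `#B'`.
  have h1 : rank N = rk N F + rk N Fᶜ := by
    rw [← hBF, h B hB, ← h B' hB', ← hBF', ← ncard_eq_rank hB', ← Set.sdiff_eq]
    exact (Set.ncard_inter_add_ncard_sdiff_eq_ncard B' F (Set.toFinite _)).symm
  -- Adding the two submodular inequalities and cancelling the rank of `N` gives the nontrivial
  -- inequality.
  have h2 := rk_submod (N := N) T F
  have h3 := rk_submod (N := N) (T ∪ F) Fᶜ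
  have h4 : (T ∪ F) ∩ Fᶜ = T \ F := by
    ext x; simp only [Set.mem_inter_iff, Set.mem_union, Set.mem_compl_iff, Set.mem_sdiff]; tauto
  have h5 : rk N ((T ∪ F) ∪ Fᶜ) = rank N := by
    rw [Set.union_assoc, Set.union_compl_self, Set.union_univ, rank, hN]
  have h6 : rk N T ≤ rk N (T ∩ F) + rk N (T \ F) := by
    conv_lhs => rw [← Set.inter_union_sdiff T F]
    exact rk_union_le _ _
  rw [h4, h5] at h3
  omega

/-- The characteristic polynomial of the restriction of `N` to `P`. -/
def restrictCharPoly (N : Matroid E) (P : Finset E) : Polynomial ℤ :=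
  ∑ T ∈ P.powerset, (-1) ^ T.card * Polynomial.X ^ (rk N (P : Set E) - rk N (T : Set E))

-- Splitting `T` into `T ∩ F` and `T \ F` is a bijection under which both the sign and the power of
-- `q` are multiplicative.
open Classical in
theorem restrictCharPoly_mul {F : Set E}
    (hF : ∀ T, rk N T = rk N (T ∩ F) + rk N (T \ F)) (P : Finset E) :
    restrictCharPoly N P =
      restrictCharPoly N (P.filter (· ∈ F)) * restrictCharPoly N (P.filter (· ∉ F)) := by
  rw [restrictCharPoly, restrictCharPoly, restrictCharPoly, Finset.sum_mul_sum,
    ← Finset.sum_product']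
  have hc1 : ∀ T : Finset E, ((T.filter (· ∈ F) : Finset E) : Set E) = (T : Set E) ∩ F := by
    intro T; ext; simp
  have hc2 : ∀ T : Finset E, ((T.filter (· ∉ F) : Finset E) : Set E) = (T : Set E) \ F := by
    intro T; ext; simp
  refine Finset.sum_nbij' (fun T => (T.filter (· ∈ F), T.filter (· ∉ F))) (fun p => p.1 ∪ p.2)
    ?_ ?_ ?_ ?_ ?_
  · intro T hT
    rw [Finset.mem_product, Finset.mem_powerset, Finset.mem_powerset]
    have hT := Finset.mem_powerset.1 hT
    exact ⟨Finset.filter_subset_filter _ hT, Finset.filter_subset_filter _ hT⟩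
  · intro p hp
    rw [Finset.mem_product, Finset.mem_powerset, Finset.mem_powerset] at hp
    exact Finset.mem_powerset.2 (Finset.union_subset (hp.1.trans (Finset.filter_subset _ _))
      (hp.2.trans (Finset.filter_subset _ _)))
  · intro T _
    exact Finset.filter_union_filter_not_eq _ T
  · rintro ⟨T, U⟩ hp
    rw [Finset.mem_product, Finset.mem_powerset, Finset.mem_powerset] at hp
    have h1 : ∀ x ∈ T, x ∈ F := fun x hx => (Finset.mem_filter.1 (hp.1 hx)).2
    have h2 : ∀ x ∈ U, x ∉ F := fun x hx => (Finset.mem_filter.1 (hp.2 hx)).2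
    refine Prod.ext ?_ ?_
    · ext x; simp only [Finset.mem_filter, Finset.mem_union]
      exact ⟨fun h => h.1.resolve_right fun hU => h2 x hU h.2, fun h => ⟨Or.inl h, h1 x h⟩⟩
    · ext x; simp only [Finset.mem_filter, Finset.mem_union]
      exact ⟨fun h => h.1.resolve_left fun hT => h.2 (h1 x hT), fun h => ⟨Or.inr h, h2 x h⟩⟩
  · intro T hT
    have hTP : (T : Set E) ⊆ P := Finset.coe_subset.2 (Finset.mem_powerset.1 hT)
    simp only [hc1, hc2]
    have e1 := hF P
    have e2 := hF T
    -- Monotonicity keeps the natural number subtractions in the exponents from truncating.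
    have l1 : rk N ((T : Set E) ∩ F) ≤ rk N ((P : Set E) ∩ F) :=
      rk_mono (Set.inter_subset_inter_left _ hTP)
    have l2 : rk N ((T : Set E) \ F) ≤ rk N ((P : Set E) \ F) :=
      rk_mono (Set.sdiff_subset_sdiff_left hTP)
    have hcard := Finset.card_filter_add_card_filter_not (s := T) (· ∈ F)
    rw [mul_mul_mul_comm, ← pow_add, ← pow_add, hcard]
    congr 2
    omega

/-- At `q = 1` the polynomial becomes the alternating count of the subsets of a nonempty set. -/
theorem X_sub_one_dvd_restrictCharPoly {P : Finset E} (hP : P.Nonempty) :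
    (Polynomial.X - 1 : Polynomial ℤ) ∣ restrictCharPoly N P := by
  have h : (Polynomial.X - 1 : Polynomial ℤ) = Polynomial.X - Polynomial.C 1 := by simp
  rw [h, Polynomial.dvd_iff_isRoot, Polynomial.IsRoot.def, restrictCharPoly,
    Polynomial.eval_finsetSum]
  simpa using Finset.sum_powerset_neg_one_pow_card_of_nonempty hP

/-- A family of separators `F`, each with an element `e_F` that is contained only in the larger
members of the family, yields one factor `q - 1` each. -/
theorem X_sub_one_pow_dvd_restrictCharPoly {α : Type*} [PartialOrder α] {S : Finset α}
    {F : α → Set E} (hF : ∀ i ∈ S, ∀ T, rk N T = rk N (T ∩ F i) + rk N (T \ F i)) {e : α → E}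
    (he : ∀ i ∈ S, e i ∈ F i) (he' : ∀ i ∈ S, ∀ j ∈ S, e i ∈ F j → i ≤ j) {P : Finset E}
    (hP : ∀ i ∈ S, e i ∈ P) :
    (Polynomial.X - 1 : Polynomial ℤ) ^ S.card ∣ restrictCharPoly N P := by
  classical
  induction S using Finset.strongInduction generalizing P with
  | H S ih =>
    rcases S.eq_empty_or_nonempty with rfl | hne
    · simp
    -- Split `P` along a minimal separator. The inside contains `e i` and gives one factor; the
    -- outside still contains every other `e j`, since `e j ∈ F i` would force `j ≤ i`.
    obtain ⟨i, hi⟩ := S.exists_minimal hne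
    rw [← Finset.card_erase_add_one hi.prop, pow_succ', restrictCharPoly_mul (hF i hi.prop)]
    refine mul_dvd_mul (X_sub_one_dvd_restrictCharPoly
      ⟨e i, Finset.mem_filter.2 ⟨hP i hi.prop, he i hi.prop⟩⟩) ?_
    have hmem : ∀ j ∈ S.erase i, j ∈ S := fun j hj => Finset.mem_of_mem_erase hj
    refine ih (S.erase i) (Finset.erase_ssubset hi.prop) (fun j hj => hF j (hmem j hj))
      (fun j hj => he j (hmem j hj)) (fun j hj k hk => he' j (hmem j hj) k (hmem k hk))
      fun j hj => Finset.mem_filter.2 ⟨hP j (hmem j hj), fun hji => ?_⟩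
    exact Finset.ne_of_mem_erase hj (hi.eq_of_le (hmem j hj) (he' j (hmem j hj) i hi.prop hji))

end Separators

/-! ### Vanishing in the presence of loops -/

section Loops

variable {E : Type*} [Fintype E] {N : Matroid E}

theorem charPoly_eq_restrictCharPoly (hN : N.E = Set.univ) :
    charPoly N = restrictCharPoly N Finset.univ := by
  simp [charPoly, restrictCharPoly, groundSubsets, rank, hN]

/-- Adding or removing the loop `e` keeps the rank and flips the sign. The function `f` is left free
so as to cover both `χ` and `χ̄`. -/
theorem sum_groundSubsets_eq_zero {e : E} (he : N.IsLoop e) (f : ℕ → Polynomial ℤ) :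
    ∑ S ∈ groundSubsets N, (-1) ^ S.card * f (rk N (S : Set E)) = 0 := by
  classical
  have heE : e ∈ (Set.toFinite N.E).toFinset := by simpa using he.mem_ground
  rw [groundSubsets, ← Finset.insert_erase heE,
    Finset.sum_powerset_insert (Finset.notMem_erase _ _), ← Finset.sum_add_distrib]
  refine Finset.sum_eq_zero fun T hT => ?_
  have heT : e ∉ T := fun h => Finset.notMem_erase _ _ (Finset.mem_powerset.1 hT h)
  have hrk : rk N (insert e (T : Set E)) = rk N (T : Set E) := by
    rw [← rk_closure, Matroid.closure_insert_eq_of_mem_closure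
      (N.closure_subset_closure (Set.empty_subset _) he), rk_closure]
  rw [Finset.card_insert_of_notMem heT, Finset.coe_insert, hrk]
  ring

theorem charPoly_eq_zero {e : E} (he : N.IsLoop e) : charPoly N = 0 :=
  sum_groundSubsets_eq_zero he fun n => Polynomial.X ^ (rank N - n)

theorem redCharPoly_eq_zero {e : E} (he : N.IsLoop e) : redCharPoly N = 0 :=
  sum_groundSubsets_eq_zero he fun n => qInt (rank N - n)

theorem isLoop_iff_forall_isBase {e : E} : N.IsLoop e ↔ e ∈ N.E ∧ ∀ B, N.IsBase B → e ∉ B := by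
  rw [Matroid.isLoop_iff_forall_mem_compl_isBase]
  obtain ⟨B, hB⟩ := N.exists_isBase
  exact ⟨fun h => ⟨(h B hB).1, fun B hB => (h B hB).2⟩, fun h B hB => ⟨h.1, h.2 B hB⟩⟩

theorem isLoop_initial {R : Type*} [AddCommGroup R] [LinearOrder R] [IsOrderedAddMonoid R]
    {w : E → R} {e : E} (he : N.IsLoop e) : (initial N w).IsLoop e := by
  rw [isLoop_iff_forall_isBase] at he ⊢
  exact ⟨he.1, fun B hB => he.2 B (initial_isBase.1 hB).1⟩

end Loops

/-! ### Nested sets as families of separators -/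

section Nested

variable {E : Type*} [Fintype E] {M : Matroid E} {𝒢 : Set (Flat M)}

/-- Two incomparable members are distinct factors of their join, and distinct factors meet in loops.
-/
theorem IsNested.inter_subset (h𝒢 : IsBuildingSet M 𝒢) {S : Finset (Flat M)} (hS : IsNested 𝒢 S)
    {F G : Flat M} (hF : F ∈ S) (hG : G ∈ S) (hFG : ¬ F ≤ G) (hGF : ¬ G ≤ F) :
    F.1 ∩ G.1 ⊆ M.closure ∅ := by
  classical
  have hne : F ≠ G := fun h => hFG h.le
  have hanti : IsAntichain (· ≤ ·) (({F, G} : Finset (Flat M)) : Set (Flat M)) := by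
    intro A hA B hB hAB
    simp only [Finset.coe_insert, Finset.coe_singleton, Set.mem_insert_iff,
      Set.mem_singleton_iff] at hA hB
    rcases hA with rfl | rfl <;> rcases hB with rfl | rfl
    · exact absurd rfl hAB
    · exact hFG
    · exact hGF
    · exact absurd rfl hAB
  obtain ⟨h1, h2⟩ := hS.factors_joinFlat h𝒢 (A := {F, G})
    (Finset.insert_subset hF (Finset.singleton_subset_iff.2 hG)) hanti (Finset.insert_nonempty _ _)
  exact (h𝒢.factors_spec h2).2.1 F (by simp [h1]) G (by simp [h1]) hne

/-- If the smaller members of `S` covered `F`, their join would be `F` and `F`, being its own only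
factor, would be one of them. An element of `F` outside them also avoids the incomparable members,
which are disjoint from `F` for lack of loops. -/
theorem IsNested.exists_mem_forall_le (h𝒢 : IsBuildingSet M 𝒢) (h0 : M.closure ∅ = ∅)
    {S : Finset (Flat M)} (hS : IsNested 𝒢 S) {F : Flat M} (hF : F ∈ S) :
    ∃ e ∈ F.1, ∀ G ∈ S, e ∈ G.1 → F ≤ G := by
  classical
  let T := S.filter (· < F)
  have hT : IsNested 𝒢 T := hS.mono (Finset.filter_subset _ _)
  obtain ⟨e, he, heT⟩ : ∃ e ∈ F.1, e ∉ ⋃ G ∈ T, G.1 := by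
    by_contra! hc
    have hTne : T.Nonempty := by
      obtain ⟨e, he, -⟩ := Set.not_subset.1 (h𝒢.1 F (hS.1 F hF)).not_ge
      obtain ⟨G, hG, -⟩ := Set.mem_iUnion₂.1 (hc e he)
      exact ⟨G, hG⟩
    have hjoin : joinFlat M (maximals T) = F := by
      apply Subtype.ext
      rw [hT.join_maximals h𝒢 hTne]
      exact Set.Subset.antisymm
        (Set.iUnion₂_subset fun G hG => (Finset.mem_filter.1 hG).2.le) hc
    have h1 := (hT.factors_join_maximals h𝒢 hTne).1
    rw [hjoin, factors_of_mem (hS.1 F hF)] at h1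
    have hFm : F ∈ maximals T := by rw [← Finset.mem_coe, ← h1]; rfl
    exact (Finset.mem_filter.1 (maximals_subset T hFm)).2.ne rfl
  refine ⟨e, he, fun G hG heG => ?_⟩
  by_contra hFG
  by_cases hGF : G ≤ F
  · exact heT (Set.mem_biUnion (x := G)
      (Finset.mem_filter.2 ⟨hG, lt_of_le_not_ge hGF hFG⟩) heG)
  · have := hS.inter_subset h𝒢 hF hG hFG hGF ⟨he, heG⟩
    rw [h0] at this
    exact this

theorem IsNested.exists_witness (h𝒢 : IsBuildingSet M 𝒢) (h0 : M.closure ∅ = ∅)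
    {S : Finset (Flat M)} (hS : IsNested 𝒢 S) (e₀ : E) :
    ∃ e : Flat M → E, ∀ F ∈ S, e F ∈ F.1 ∧ ∀ G ∈ S, e F ∈ G.1 → F ≤ G := by
  have hex : ∀ F : Flat M, ∃ e, F ∈ S → e ∈ F.1 ∧ ∀ G ∈ S, e ∈ G.1 → F ≤ G := by
    intro F
    by_cases hF : F ∈ S
    · obtain ⟨e, he⟩ := hS.exists_mem_forall_le h𝒢 h0 hF
      exact ⟨e, fun _ => he⟩
    · exact ⟨e₀, fun h => absurd h hF⟩
  choose e he using hex
  exact ⟨e, he⟩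

theorem coe_topFlat (hE : M.E = Set.univ) : (topFlat M).1 = Set.univ := hE

/-- The factors of `E` cover `E`. Conversely, if `S` covers `E`, its maximal members have join `E`
and so are its factors. This turns the condition defining `𝒩*` into positivity of the lattice points
in the cone. -/
theorem IsNested.factors_topFlat_subset_iff (h𝒢 : IsBuildingSet M 𝒢) (h0 : M.closure ∅ = ∅)
    (hE : M.E = Set.univ) {S : Finset (Flat M)} (hS : IsNested 𝒢 S) :
    factors 𝒢 (topFlat M) ⊆ (S : Set (Flat M)) ↔ ∀ e, ∃ F ∈ S, e ∈ F.1 := by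
  constructor
  · intro h e
    have hbot : botFlat M < topFlat M := by
      refine lt_of_le_not_ge (botFlat_le _) fun hle => ?_
      have : e ∈ M.closure ∅ := hle (by rw [coe_topFlat hE]; trivial)
      rw [h0] at this
      exact this
    obtain ⟨G, hG, heG⟩ := (h𝒢.factors_spec hbot).1 e (by rw [coe_topFlat hE]; trivial)
    exact ⟨G, h hG, heG⟩
  · intro h G hG
    obtain ⟨e, -, -⟩ := Set.not_subset.1 (h𝒢.1 G (mem_of_mem_factors hG)).not_ge
    obtain ⟨F, hF, -⟩ := h e
    have hjoin : joinFlat M (maximals S) = topFlat M := by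
      apply Subtype.ext
      rw [hS.join_maximals h𝒢 ⟨F, hF⟩, coe_topFlat hE]
      exact Set.eq_univ_of_forall fun e => by
        obtain ⟨F, hF, heF⟩ := h e
        exact Set.mem_biUnion hF heF
    rw [← hjoin, (hS.factors_join_maximals h𝒢 ⟨F, hF⟩).1] at hG
    exact maximals_subset S hG

theorem IsNested.rk_initialNested (h𝒢 : IsBuildingSet M 𝒢) (hE : M.E = Set.univ)
    {S : Finset (Flat M)} (hS : IsNested 𝒢 S) {F : Flat M} (hF : F ∈ S) (T : Set E) :
    rk (initialNested M S) T =
      rk (initialNested M S) (T ∩ F.1) + rk (initialNested M S) (T \ F.1) :=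
  rk_eq_add_of_ncard_inter (N := initialNested M S) hE
    (fun _ hB => ((hS.initialNested_isBase h𝒢).1 hB).2 F hF) T

theorem isLoop_initialNested {e : E} (he : M.IsLoop e) {S : Finset (Flat M)} :
    (initialNested M S).IsLoop e := isLoop_initial he

theorem exists_isLoop (h0 : M.closure ∅ ≠ ∅) : ∃ e, M.IsLoop e :=
  Set.nonempty_iff_ne_empty.2 h0

theorem IsNested.X_sub_one_pow_dvd_charPoly (h𝒢 : IsBuildingSet M 𝒢) (hE : M.E = Set.univ)
    {S : Finset (Flat M)} (hS : IsNested 𝒢 S) :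
    (Polynomial.X - 1) ^ S.card ∣ charPoly (initialNested M S) := by
  by_cases h0 : M.closure ∅ = ∅
  · rcases S.eq_empty_or_nonempty with rfl | ⟨F, hF⟩
    · simp
    obtain ⟨e₀, -⟩ := hS.exists_mem_forall_le h𝒢 h0 hF
    obtain ⟨e, he⟩ := hS.exists_witness h𝒢 h0 e₀
    rw [charPoly_eq_restrictCharPoly (N := initialNested M S) hE]
    exact X_sub_one_pow_dvd_restrictCharPoly (F := fun F : Flat M => F.1)
      (fun F hF => hS.rk_initialNested h𝒢 hE hF)
      (fun F hF => (he F hF).1) (fun F hF => (he F hF).2) fun _ _ => Finset.mem_univ _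
  · obtain ⟨e, he⟩ := exists_isLoop h0
    rw [charPoly_eq_zero (N := initialNested M S) (isLoop_initialNested he)]
    exact dvd_zero _

/-- The whole ground set is one more, trivial, separator; its own element is an `e₀` that no member
of `S` contains. The extra factor `q - 1` of `χ` is the one lost in passing to `χ̄`. -/
theorem IsNested.X_sub_one_pow_dvd_redCharPoly (h𝒢 : IsBuildingSet M 𝒢) (hE : M.E = Set.univ)
    {S : Finset (Flat M)} (hS : IsNested 𝒢 S)
    (htop : ¬ factors 𝒢 (topFlat M) ⊆ (S : Set (Flat M))) :
    (Polynomial.X - 1) ^ S.card ∣ redCharPoly (initialNested M S) := by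
  classical
  by_cases h0 : M.closure ∅ = ∅
  · rw [hS.factors_topFlat_subset_iff h𝒢 h0 hE] at htop
    push Not at htop
    obtain ⟨e₀, he₀⟩ := htop
    obtain ⟨e, he⟩ := hS.exists_witness h𝒢 h0 e₀
    have hS' : topFlat M ∉ S := fun h => he₀ _ h (by rw [coe_topFlat hE]; trivial)
    have hle : ∀ F : Flat M, F ≤ topFlat M := fun F => F.2.subset_ground
    have hdvd : (Polynomial.X - 1) ^ (S.card + 1) ∣ charPoly (initialNested M S) := by
      rw [charPoly_eq_restrictCharPoly (N := initialNested M S) hE,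
        ← Finset.card_insert_of_notMem hS']
      refine X_sub_one_pow_dvd_restrictCharPoly (F := fun F : Flat M => F.1)
        (e := fun F => if F ∈ S then e F else e₀) ?_ ?_ ?_ fun _ _ => Finset.mem_univ _
      · intro F hF T
        rcases Finset.mem_insert.1 hF with rfl | hF
        · have hT : ∀ T : Set E, T ⊆ (topFlat M).1 := fun T => by
            rw [coe_topFlat hE]; exact Set.subset_univ T
          rw [Set.inter_eq_left.2 (hT T), Set.sdiff_eq_empty.2 (hT T), rk_empty, add_zero]
        · exact hS.rk_initialNested h𝒢 hE hF T
      · intro F hF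
        by_cases hFS : F ∈ S
        · simp only [hFS, if_true]; exact (he F hFS).1
        · rw [(Finset.mem_insert.1 hF).resolve_right hFS, coe_topFlat hE]; trivial
      · intro F hF G hG heFG
        rcases Finset.mem_insert.1 hG with rfl | hG
        · exact hle F
        by_cases hFS : F ∈ S
        · simp only [hFS, if_true] at heFG; exact (he F hFS).2 G hG heFG
        · simp only [hFS, if_false] at heFG; exact absurd heFG (he₀ G hG)
    have hne : (initialNested M S).E.Nonempty := ⟨e₀, by
      change e₀ ∈ M.E
      rw [hE]; trivial⟩
    rw [← redCharPoly_mul _ hne, pow_succ] at hdvd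
    refine (mul_dvd_mul_iff_right ?_).1 hdvd
    simpa using Polynomial.X_sub_C_ne_zero (1 : ℤ)
  · obtain ⟨e, he⟩ := exists_isLoop h0
    rw [redCharPoly_eq_zero (N := initialNested M S) (isLoop_initialNested he)]
    exact dvd_zero _

end Nested

/-! ### Integer points of the nested set fan -/

section Fan

variable {E : Type*} [Fintype E] {M : Matroid E} {𝒢 : Set (Flat M)}

/-- The support of a family of multiplicities. -/
def supp (k : Flat M → ℕ) : Finset (Flat M) := (Set.toFinite {F | k F ≠ 0}).toFinset

theorem mem_supp {k : Flat M → ℕ} {F : Flat M} : F ∈ supp k ↔ k F ≠ 0 := by simp [supp]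

/-- The integer vector `∑_F k_F v_F`. -/
def fanPoint (k : Flat M → ℕ) : E → ℤ := flatSum (fun F => (k F : ℤ)) (supp k)

theorem fanPoint_apply [Fintype (Flat M)] (k : Flat M → ℕ) (e : E) :
    fanPoint k e = ∑ F : Flat M, F.1.indicator (fun _ => (k F : ℤ)) e := by
  classical
  rw [fanPoint, flatSum_apply]
  refine Finset.sum_subset (Finset.subset_univ _) fun F _ hF => ?_
  have : k F = 0 := by simpa [mem_supp] using hF
  simp [this]

theorem fanPoint_add (k l : Flat M → ℕ) (e : E) :
    fanPoint (k + l) e = fanPoint k e + fanPoint l e := by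
  classical
  have := Fintype.ofFinite (Flat M)
  simp only [fanPoint_apply, ← Finset.sum_add_distrib]
  refine Finset.sum_congr rfl fun F _ => ?_
  by_cases he : e ∈ F.1 <;> simp [he]

theorem fanPoint_nonneg (k : Flat M → ℕ) (e : E) : 0 ≤ fanPoint k e := by
  rw [fanPoint, flatSum_apply]
  exact Finset.sum_nonneg fun F _ => Set.indicator_nonneg (fun _ _ => Int.natCast_nonneg _) _

theorem fanPoint_pos_iff (k : Flat M → ℕ) (e : E) :
    0 < fanPoint k e ↔ ∃ F ∈ supp k, e ∈ F.1 := by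
  classical
  rw [fanPoint, flatSum_apply, Finset.sum_pos_iff_of_nonneg
    fun F _ => Set.indicator_nonneg (fun _ _ => Int.natCast_nonneg _) _]
  refine exists_congr fun F => and_congr_right fun hF => ?_
  have := Nat.pos_of_ne_zero (mem_supp.1 hF)
  by_cases he : e ∈ F.1 <;> simp [he, this]

theorem size_fanPoint (k : Flat M → ℕ) :
    size (fanPoint k) = ∑ F ∈ supp k, (F.1.ncard : ℤ) * k F := by
  classical
  simp_rw [← sum_indicator_const]
  rw [Finset.sum_comm, size]
  exact Finset.sum_congr rfl fun e _ => by rw [fanPoint, flatSum_apply]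

theorem wt_fanPoint (h𝒢 : IsBuildingSet M 𝒢) {k : Flat M → ℕ} (hk : IsNested 𝒢 (supp k)) :
    wt M (fanPoint k) = ∑ F ∈ supp k, (rk M F.1 : ℤ) * k F := by
  refine (hk.wt_flatSum h𝒢 fun F hF => ?_).trans (by simp)
  exact_mod_cast Nat.pos_of_ne_zero (mem_supp.1 hF)

theorem initial_fanPoint (h𝒢 : IsBuildingSet M 𝒢) {k : Flat M → ℕ} (hk : IsNested 𝒢 (supp k)) :
    initial M (fanPoint k) = initialNested M (supp k) :=
  hk.initial_flatSum h𝒢 fun F hF => by exact_mod_cast Nat.pos_of_ne_zero (mem_supp.1 hF)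

theorem nonempty_of_mem (h𝒢 : IsBuildingSet M 𝒢) {F : Flat M} (hF : F ∈ 𝒢) : F.1.Nonempty := by
  obtain ⟨e, he, -⟩ := Set.not_subset.1 (h𝒢.1 F hF).not_ge
  exact ⟨e, he⟩

theorem supp_eq_empty {k : Flat M → ℕ} : supp k = ∅ ↔ k = 0 := by
  simp [Finset.eq_empty_iff_forall_notMem, mem_supp, funext_iff]

/-- Both sides are the factors of the flat on which the common vector is positive. -/
theorem maximals_supp_eq (h𝒢 : IsBuildingSet M 𝒢) {k l : Flat M → ℕ} (hk : IsNested 𝒢 (supp k))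
    (hl : IsNested 𝒢 (supp l)) (hk0 : (supp k).Nonempty) (hl0 : (supp l).Nonempty)
    (h : fanPoint k = fanPoint l) : maximals (supp k) = maximals (supp l) := by
  have hU : ∀ k : Flat M → ℕ, ⋃ F ∈ supp k, F.1 = {e | 0 < fanPoint k e} := fun k => by
    ext e
    simp [fanPoint_pos_iff]
  have hj : joinFlat M (maximals (supp k)) = joinFlat M (maximals (supp l)) := by
    apply Subtype.ext
    rw [hk.join_maximals h𝒢 hk0, hl.join_maximals h𝒢 hl0, hU, hU, h]
  have := (hk.factors_join_maximals h𝒢 hk0).1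
  rw [hj, (hl.factors_join_maximals h𝒢 hl0).1] at this
  exact (Finset.coe_injective this).symm

/-- Induction on the total multiplicity: the vector determines the maximal members of the support,
and one copy of each can be subtracted from both sides. -/
theorem fanPoint_injOn (h𝒢 : IsBuildingSet M 𝒢) :
    Set.InjOn (fanPoint (M := M)) {k | IsNested 𝒢 (supp k)} := by
  classical
  suffices H : ∀ n : ℕ, ∀ k l : Flat M → ℕ, ∑ F ∈ supp k, k F ≤ n → IsNested 𝒢 (supp k) →
      IsNested 𝒢 (supp l) → fanPoint k = fanPoint l → k = l from
    fun k hk l hl h => H _ k l le_rfl hk hl h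
  have hsupp : ∀ k l : Flat M → ℕ, IsNested 𝒢 (supp k) → fanPoint k = fanPoint l →
      (supp k).Nonempty → (supp l).Nonempty := by
    rintro k l hk h ⟨F, hF⟩
    obtain ⟨e, he⟩ := nonempty_of_mem h𝒢 (hk.1 F hF)
    have : 0 < fanPoint k e := (fanPoint_pos_iff k e).2 ⟨F, hF, he⟩
    rw [h] at this
    obtain ⟨G, hG, -⟩ := (fanPoint_pos_iff l e).1 this
    exact ⟨G, hG⟩
  intro n
  induction n with
  | zero =>
    intro k l hn hk hl h
    have hk0 : supp k = ∅ := by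
      rw [Finset.eq_empty_iff_forall_notMem]
      intro F hF
      exact mem_supp.1 hF ((Finset.sum_eq_zero_iff.1 (Nat.le_zero.1 hn)) F hF)
    have hl0 : supp l = ∅ := by
      by_contra hne
      have := hsupp l k hl h.symm (Finset.nonempty_iff_ne_empty.2 hne)
      exact this.ne_empty hk0
    rw [supp_eq_empty.1 hk0, supp_eq_empty.1 hl0]
  | succ n ih =>
    intro k l hn hk hl h
    by_cases hk0 : (supp k).Nonempty
    swap
    · have hl0 : ¬ (supp l).Nonempty := fun h' => hk0 (hsupp l k hl h.symm h')
      rw [Finset.not_nonempty_iff_eq_empty] at hk0 hl0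
      rw [supp_eq_empty.1 hk0, supp_eq_empty.1 hl0]
    have hl0 := hsupp k l hk h hk0
    have hA := maximals_supp_eq h𝒢 hk hl hk0 hl0 h
    let a : Flat M → ℕ := fun F => if F ∈ maximals (supp k) then 1 else 0
    have hsub : ∀ m : Flat M → ℕ, maximals (supp m) = maximals (supp k) →
        (fun F => m F - a F) + a = m := by
      intro m hm
      funext F
      simp only [Pi.add_apply, a]
      split_ifs with hF
      · have := mem_supp.1 (maximals_subset _ (hm ▸ hF))
        omega
      · simp
    have hss : ∀ m : Flat M → ℕ, supp (fun F => m F - a F) ⊆ supp m := by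
      intro m F hF
      rw [mem_supp] at hF ⊢
      omega
    have h1 := hsub k rfl
    have h2 := hsub l hA.symm
    have heq : (fun F => k F - a F) = fun F => l F - a F := by
      refine ih _ _ ?_ (hk.mono (hss k)) (hl.mono (hss l)) ?_
      · obtain ⟨F, hF⟩ := maximals_nonempty hk0
        refine Nat.lt_succ_iff.1 (lt_of_lt_of_le ?_ hn)
        refine (Finset.sum_le_sum_of_subset (hss k)).trans_lt (Finset.sum_lt_sum
          (fun G _ => Nat.sub_le _ _) ⟨F, maximals_subset _ hF, ?_⟩)
        have := mem_supp.1 (maximals_subset _ hF)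
        simp only [a, hF, if_true]
        omega
      · funext e
        have e1 := fanPoint_add (fun F => k F - a F) a e
        have e2 := fanPoint_add (fun F => l F - a F) a e
        rw [h1] at e1
        rw [h2, ← h, e1] at e2
        exact add_right_cancel e2
    rw [← h1, ← h2, heq]

/-- The factors of the members of a chain of flats form a nested set. -/
theorem isNested_of_chain {S : Finset (Flat M)} {X : ℕ → Flat M} (hX : Antitone X)
    (hS : ∀ F ∈ S, ∃ t, F ∈ factors 𝒢 (X t)) : IsNested 𝒢 S := by
  classical
  have hS' : ∀ F, ∃ t, F ∈ S → F ∈ factors 𝒢 (X t) := by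
    intro F
    by_cases hF : F ∈ S
    · obtain ⟨t, ht⟩ := hS F hF
      exact ⟨t, fun _ => ht⟩
    · exact ⟨0, fun h => absurd h hF⟩
  choose t ht using hS'
  refine ⟨fun F hF => mem_of_mem_factors (ht F hF), fun A hA hcard hanti hmem => ?_⟩
  -- The least index belongs to the largest flat `X (t F)`, which contains the whole join. If the
  -- join were in `𝒢`, maximality of the factor `F` would make it equal to `F`, above all other
  -- members of `A`.
  obtain ⟨F, hF, hmin⟩ := A.exists_min_image t (Finset.card_pos.1 (by omega))
  have hle : joinFlat M A ≤ X (t F) := joinFlat_le fun G hG =>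
    (le_of_mem_factors (ht G (hA hG))).trans (hX (hmin G hG))
  have heq := eq_of_mem_factors (ht F (hA hF)) hmem hle (subset_joinFlat hF)
  obtain ⟨G, hG, hGF⟩ := Finset.exists_mem_ne hcard F
  refine hanti (Finset.mem_coe.2 hG) (Finset.mem_coe.2 hF) hGF ?_
  rw [heq]
  exact subset_joinFlat hG

/-- Layer by layer, `w` is the sum over `t ≥ 1` of the indicators of `{w ≥ t}`, and without loops
each such flat is the disjoint union of its factors. -/
theorem exists_fanPoint_eq (h𝒢 : IsBuildingSet M 𝒢) (h0 : M.closure ∅ = ∅) {w : E → ℤ}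
    (hw0 : ∀ e, 0 ≤ w e) (hw : ∀ t : ℤ, M.IsFlat {e | t ≤ w e}) :
    ∃ k : Flat M → ℕ, IsNested 𝒢 (supp k) ∧ fanPoint k = w := by
  classical
  have := Fintype.ofFinite (Flat M)
  obtain ⟨N, hN⟩ : ∃ N : ℕ, ∀ e, w e ≤ N :=
    ⟨∑ e, (w e).toNat, fun e => by
      have : (w e).toNat ≤ ∑ e, (w e).toNat :=
        Finset.single_le_sum (f := fun e => (w e).toNat) (fun _ _ => Nat.zero_le _)
          (Finset.mem_univ e)
      have := hw0 e
      omega⟩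
  let X : ℕ → Flat M := fun t => ⟨{e | (t : ℤ) ≤ w e}, hw t⟩
  have hX : Antitone X := fun s t hst e (he : (t : ℤ) ≤ w e) =>
    show (s : ℤ) ≤ w e by omega
  -- Levels start at 1, since `X 0` is all of `E` and is not a layer of `w`; beyond `N` the
  -- superlevel sets are empty.
  let k : Flat M → ℕ := fun F => ((Finset.Icc 1 N).filter fun t => F ∈ factors 𝒢 (X t)).card
  refine ⟨k, isNested_of_chain hX fun F hF => ?_, ?_⟩
  · obtain ⟨t, ht⟩ := Finset.card_ne_zero.1 (mem_supp.1 hF)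
    exact ⟨t, (Finset.mem_filter.1 ht).2⟩
  · funext e
    have h1 : ∀ t : ℕ, ∑ F : Flat M, (if F ∈ factors 𝒢 (X t) ∧ e ∈ F.1 then (1 : ℤ) else 0) =
        if (t : ℤ) ≤ w e then 1 else 0 := by
      intro t
      split_ifs with ht
      · have hbot : botFlat M < X t := by
          refine lt_of_le_not_ge (botFlat_le _) fun hle => ?_
          have : e ∈ M.closure ∅ := hle ht
          rw [h0] at this
          exact this
        obtain ⟨hcov, hdis, -⟩ := h𝒢.factors_spec hbot
        obtain ⟨G, hG, heG⟩ := hcov e ht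
        rw [Finset.sum_eq_single G, if_pos ⟨hG, heG⟩]
        · intro H _ hHG
          rw [if_neg]
          rintro ⟨hH, heH⟩
          have := hdis H hH G hG hHG ⟨heH, heG⟩
          rw [h0] at this
          exact this
        · simp
      · refine Finset.sum_eq_zero fun F _ => if_neg ?_
        rintro ⟨hF, heF⟩
        exact ht (le_of_mem_factors hF heF)
    calc fanPoint k e = ∑ F : Flat M, ∑ t ∈ Finset.Icc 1 N,
          (if F ∈ factors 𝒢 (X t) ∧ e ∈ F.1 then (1 : ℤ) else 0) := by
          rw [fanPoint_apply]
          refine Finset.sum_congr rfl fun F _ => ?_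
          by_cases he : e ∈ F.1 <;> simp [he, k]
      _ = ∑ t ∈ Finset.Icc 1 N, (if (t : ℤ) ≤ w e then 1 else 0) := by
          rw [Finset.sum_comm]
          exact Finset.sum_congr rfl fun t _ => h1 t
      _ = w e := by
          have h2 : (Finset.Icc 1 N).filter (fun t : ℕ => (t : ℤ) ≤ w e) =
              Finset.Icc 1 (w e).toNat := by
            ext t
            have := hN e
            have := hw0 e
            simp only [Finset.mem_filter, Finset.mem_Icc]
            omega
          rw [← Finset.sum_filter, h2]
          have := hw0 e
          simp [this]

/-- If `M_w` is loopless, then the superlevel sets of `w` are flats. -/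
theorem isFlat_superlevel (hE : M.E = Set.univ) {w : E → ℤ}
    (hw : ∀ e, ¬ (initial M w).IsLoop e) (t : ℤ) : M.IsFlat {e | t ≤ w e} := by
  rw [Matroid.isFlat_iff_closure_eq]
  refine Set.Subset.antisymm (fun e he => ?_) (M.subset_closure _ (hE ▸ Set.subset_univ _))
  by_contra hlt
  have hlt' : w e < t := not_le.1 hlt
  have he' := hw e
  rw [isLoop_iff_forall_isBase] at he'
  push Not at he'
  obtain ⟨B, hB, heB⟩ := he' (by
    change e ∈ M.E
    rw [hE]; trivial)
  obtain ⟨hB, hBw⟩ := initial_isBase.1 hB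
  -- `B` has maximal weight and contains `e`, of weight below `t`. An element `f` of weight at least
  -- `t` outside the closure of `B \ {e}` can replace `e` and raise the weight.
  have hnot : ¬ {e | t ≤ w e} ⊆ M.closure (B \ {e}) := fun hsub =>
    hB.indep.notMem_closure_sdiff_of_mem heB
      (M.closure_subset_closure_of_subset_closure hsub he)
  obtain ⟨f, hf, hfcl⟩ := Set.not_subset.1 hnot
  have hf' : t ≤ w f := hf
  have hfe : f ≠ e := by rintro rfl; omega
  have hfB : f ∉ B := fun h =>
    hfcl (M.subset_closure _ (Set.sdiff_subset.trans hB.subset_ground) ⟨h, hfe⟩)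
  have hB' := hB.exchange_base_of_notMem_closure heB hfcl (hE ▸ Set.mem_univ f)
  have := setWeight_le_wt w hB'
  rw [setWeight_exchange w heB hfB, hBw] at this
  omega

end Fan

/-! ### Formal sums -/

section FormalSum

variable {ι κ : Type*}

theorem coeff_formalSum (A : Set ι) (deg : ι → ℤ) (c : ι → LaurentPolynomial ℤ) (n : ℕ) :
    PowerSeries.coeff n (formalSum A deg c) = ∑ᶠ i ∈ {i | i ∈ A ∧ deg i = (n : ℤ)}, c i :=
  PowerSeries.coeff_mk _ _

theorem formalSum_congr {A : Set ι} {deg deg' : ι → ℤ} {c c' : ι → LaurentPolynomial ℤ}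
    (hdeg : ∀ i ∈ A, deg i = deg' i) (hc : ∀ i ∈ A, c i = c' i) :
    formalSum A deg c = formalSum A deg' c' := by
  ext1 n
  rw [coeff_formalSum, coeff_formalSum]
  refine finsum_mem_congr ?_ fun i hi => hc i hi.1
  ext i
  exact and_congr_right fun hi => by rw [hdeg i hi]

theorem formalSum_eq_zero {A : Set ι} {deg : ι → ℤ} {c : ι → LaurentPolynomial ℤ}
    (hc : ∀ i ∈ A, c i = 0) : formalSum A deg c = 0 := by
  ext1 n
  rw [coeff_formalSum, finsum_mem_eq_zero_of_forall_eq_zero fun i hi => hc i hi.1, map_zero]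

theorem formalSum_eq_of_subset {A B : Set ι} (hBA : B ⊆ A) {deg : ι → ℤ}
    {c : ι → LaurentPolynomial ℤ} (hc : ∀ i ∈ A, i ∉ B → c i = 0) :
    formalSum A deg c = formalSum B deg c := by
  ext1 n
  rw [coeff_formalSum, coeff_formalSum]
  refine finsum_mem_inter_support_eq' _ _ _ fun i hi => ?_
  refine and_congr_left fun _ => ⟨fun hA => ?_, fun hB => hBA hB⟩
  by_contra hB
  exact hi (hc i hA hB)

theorem formalSum_eq_of_bijOn {A : Set ι} {B : Set κ} {deg : ι → ℤ} {deg' : κ → ℤ}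
    {c : ι → LaurentPolynomial ℤ} {c' : κ → LaurentPolynomial ℤ} (e : ι → κ) (he : Set.BijOn e A B)
    (hdeg : ∀ i ∈ A, deg i = deg' (e i)) (hc : ∀ i ∈ A, c i = c' (e i)) :
    formalSum A deg c = formalSum B deg' c' := by
  ext1 n
  rw [coeff_formalSum, coeff_formalSum]
  refine finsum_mem_eq_of_bijOn e ⟨?_, ?_, ?_⟩ fun i hi => hc i hi.1
  · exact fun i hi => ⟨he.mapsTo hi.1, by rw [← hdeg i hi.1, hi.2]⟩
  · exact he.injOn.mono fun i hi => hi.1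
  · rintro j ⟨hj, hjn⟩
    obtain ⟨i, hi, rfl⟩ := he.surjOn hj
    exact ⟨i, ⟨hi, by rw [hdeg i hi, hjn]⟩, rfl⟩

/-- Finite fibres are required because `finsum` takes the value 0 on an infinite support. -/
theorem formalSum_biUnion {T : Finset κ} {A : κ → Set ι} {deg : ι → ℤ}
    {c : ι → LaurentPolynomial ℤ} (hdisj : (T : Set κ).PairwiseDisjoint A)
    (hfin : ∀ j ∈ T, ∀ n : ℤ, {i | i ∈ A j ∧ deg i = n}.Finite) :
    formalSum (⋃ j ∈ T, A j) deg c = ∑ j ∈ T, formalSum (A j) deg c := by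
  ext1 n
  rw [coeff_formalSum, map_sum]
  simp_rw [coeff_formalSum]
  have hset : {i | i ∈ ⋃ j ∈ T, A j ∧ deg i = (n : ℤ)} =
      ⋃ j ∈ (T : Set κ), {i | i ∈ A j ∧ deg i = (n : ℤ)} := by
    ext i
    simp only [Set.mem_ofPred_eq, Set.mem_iUnion, Finset.mem_coe, exists_prop]
    exact ⟨fun ⟨⟨j, hj, hi⟩, h⟩ => ⟨j, hj, hi, h⟩, fun ⟨j, hj, hi, h⟩ => ⟨⟨j, hj, hi⟩, h⟩⟩
  rw [hset, finsum_mem_biUnion (hdisj.mono fun j i hi => hi.1) T.finite_toSet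
    (fun j hj => hfin j hj n), finsum_mem_coe_finset]

theorem C_mul_formalSum {A : Set ι} {deg : ι → ℤ} {c : ι → LaurentPolynomial ℤ}
    (hfin : ∀ n : ℤ, {i | i ∈ A ∧ deg i = n}.Finite) (a : LaurentPolynomial ℤ) :
    PowerSeries.C a * formalSum A deg c = formalSum A deg fun i => a * c i := by
  ext1 n
  rw [PowerSeries.coeff_C_mul, coeff_formalSum, coeff_formalSum]
  exact AddMonoidHom.map_finsum_mem _ (AddMonoidHom.mulLeft a) (hfin n)

/-- A formal sum discards negative degrees, which the shift by `d` could bring back; hence the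
hypothesis on `deg`. -/
theorem X_pow_mul_formalSum {A : Set ι} {deg : ι → ℤ} {c : ι → LaurentPolynomial ℤ}
    (hdeg : ∀ i ∈ A, 0 ≤ deg i) (d : ℕ) :
    PowerSeries.X ^ d * formalSum A deg c = formalSum A (fun i => deg i + d) c := by
  ext1 n
  rw [PowerSeries.coeff_X_pow_mul', coeff_formalSum, coeff_formalSum]
  split_ifs with h
  · refine finsum_mem_congr ?_ fun _ _ => rfl
    ext i
    refine and_congr_right fun _ => ?_
    push_cast [h]
    omega
  · refine (finsum_mem_eq_zero_of_forall_eq_zero fun i hi => ?_).symm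
    have h1 := hdeg i hi.1
    have h2 : deg i + d = n := hi.2
    omega

end FormalSum

/-! ### Expansion of the rational expressions -/

section Expansion

variable {E : Type*} [Fintype E] {M : Matroid E} {𝒢 : Set (Flat M)}

/-- The linear function on multiplicities with value `rk F` on the flat `F`. -/
def fanRk (k : Flat M → ℕ) : ℤ := ∑ F ∈ supp k, (rk M F.1 : ℤ) * k F

theorem fanRk_eq [Fintype (Flat M)] (k : Flat M → ℕ) : fanRk k = ∑ F, (rk M F.1 : ℤ) * k F := by
  refine Finset.sum_subset (Finset.subset_univ _) fun F _ hF => ?_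
  have : k F = 0 := by simpa [mem_supp] using hF
  simp [this]

theorem size_fanPoint_eq [Fintype (Flat M)] (k : Flat M → ℕ) :
    size (fanPoint k) = ∑ F : Flat M, (F.1.ncard : ℤ) * k F := by
  rw [size_fanPoint]
  refine Finset.sum_subset (Finset.subset_univ _) fun F _ hF => ?_
  have : k F = 0 := by simpa [mem_supp] using hF
  simp [this]

open Classical in
theorem fanRk_add_single (k : Flat M → ℕ) (F : Flat M) :
    fanRk (k + Pi.single F 1) = fanRk k + rk M F.1 := by
  have := Fintype.ofFinite (Flat M)
  simp [fanRk_eq, mul_add, Finset.sum_add_distrib, Pi.single_apply]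

open Classical in
theorem size_fanPoint_add_single (k : Flat M → ℕ) (F : Flat M) :
    size (fanPoint (k + Pi.single F 1)) = size (fanPoint k) + F.1.ncard := by
  have := Fintype.ofFinite (Flat M)
  simp [size_fanPoint_eq, mul_add, Finset.sum_add_distrib, Pi.single_apply]

theorem size_nonneg {w : E → ℤ} (h : ∀ e, 0 ≤ w e) : 0 ≤ size w := Finset.sum_nonneg fun e _ => h e

theorem finite_fanPoint_fiber {S : Finset (Flat M)} (hS : ∀ F ∈ S, F.1.Nonempty) (n : ℤ) :
    {k : Flat M → ℕ | k ∈ {k | supp k = S} ∧ size (fanPoint k) = n}.Finite := by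
  classical
  have := Fintype.ofFinite (Flat M)
  refine (Set.finite_Icc (0 : Flat M → ℕ) fun _ => n.toNat).subset ?_
  rintro k ⟨rfl, hn⟩
  refine ⟨fun F => Nat.zero_le _, fun F => ?_⟩
  by_cases hF : F ∈ supp k
  · have h1 : 0 < F.1.ncard := (Set.ncard_pos (Set.toFinite _)).2 (hS F hF)
    have h2 : (F.1.ncard : ℤ) * k F ≤ n := by
      rw [← hn, size_fanPoint]
      exact Finset.single_le_sum (f := fun F : Flat M => (F.1.ncard : ℤ) * k F)
        (fun _ _ => by positivity) hF
    have h3 : (k F : ℤ) ≤ F.1.ncard * k F :=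
      le_mul_of_one_le_left (Int.natCast_nonneg _) (by exact_mod_cast h1)
    change k F ≤ n.toNat
    omega
  · have : k F = 0 := by simpa [mem_supp] using hF
    simp [this]

-- On index sets, this is the recursion `s = m (1 + s)` for the geometric series `s = m + m^2 + ⋯`.
open Classical in
theorem bijOn_add_single {S : Finset (Flat M)} {F : Flat M} (hF : F ∉ S) :
    Set.BijOn (fun k : Flat M → ℕ => k + Pi.single F 1)
      ({k | supp k = S} ∪ {k | supp k = insert F S}) {k | supp k = insert F S} := by
  have hsupp : ∀ k : Flat M → ℕ, supp (k + Pi.single F 1) = insert F (supp k) := by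
    intro k
    ext G
    by_cases h : G = F
    · subst h; simp [mem_supp]
    · simp [mem_supp, h]
  refine ⟨?_, fun k _ l _ h => add_right_cancel h, ?_⟩
  · rintro k (rfl | hk)
    · exact hsupp k
    · change supp _ = _
      have hk' : supp k = insert F S := hk
      rw [hsupp, hk', Finset.insert_idem]
  · intro k (hk : supp k = insert F S)
    have hkF : k F ≠ 0 := mem_supp.1 (hk ▸ Finset.mem_insert_self F S)
    have hk' : (k - Pi.single F 1) + Pi.single F 1 = k := by
      funext G
      by_cases h : G = F
      · subst h
        simp only [Pi.add_apply, Pi.sub_apply, Pi.single_eq_same]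
        omega
      · simp [h]
    refine ⟨k - Pi.single F 1, ?_, hk'⟩
    have h := hsupp (k - Pi.single F 1)
    rw [hk', hk] at h
    by_cases hm : F ∈ supp (k - Pi.single F 1)
    · right
      change supp _ = _
      rw [h, Finset.insert_eq_of_mem hm]
    · left
      change supp _ = _
      rw [← Finset.erase_insert hm, ← h, Finset.erase_insert hF]

/-- The product of the geometric series `∑_{k ≥ 1} (q^{-rk F} T^{#F})^k`. -/
theorem prod_geometric {S : Finset (Flat M)} (hS : ∀ F ∈ S, F.1.Nonempty) :
    ∏ F ∈ S, (flatMonomial F * PowerSeries.invOfUnit (1 - flatMonomial F) 1) =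
      formalSum {k : Flat M → ℕ | supp k = S} (fun k => size (fanPoint k))
        fun k => LaurentPolynomial.T (-fanRk k) := by
  classical
  induction S using Finset.induction_on with
  | empty =>
    ext1 n
    have hset : {k : Flat M → ℕ | k ∈ {k : Flat M → ℕ | supp k = ∅} ∧ size (fanPoint k) = n} =
        if n = 0 then {0} else ∅ := by
      have h0 : size (fanPoint (0 : Flat M → ℕ)) = 0 := by simp [size_fanPoint]
      ext k
      simp only [Set.mem_ofPred_eq, supp_eq_empty]
      split_ifs with hn
      · subst hn
        simp only [Set.mem_singleton_iff, Nat.cast_zero]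
        exact ⟨fun h => h.1, fun h => ⟨h, h ▸ h0⟩⟩
      · simp only [Set.mem_empty_iff_false, iff_false]
        rintro ⟨rfl, h⟩
        rw [h0] at h
        omega
    rw [coeff_formalSum, hset, Finset.prod_empty, PowerSeries.coeff_one]
    split_ifs
    · simp [fanRk]
    · simp
  | insert F S hF ih =>
    have ih := ih fun G hG => hS G (Finset.mem_insert_of_mem hG)
    rw [Finset.prod_insert hF, ih]
    set P := formalSum {k : Flat M → ℕ | supp k = S} (fun k => size (fanPoint k))
      fun k => LaurentPolynomial.T (-fanRk k)
    set Q := formalSum {k : Flat M → ℕ | supp k = insert F S} (fun k => size (fanPoint k))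
      fun k => LaurentPolynomial.T (-fanRk k) with hQ
    let R : Bool → Set (Flat M → ℕ) := fun b => {k | supp k = if b then S else insert F S}
    have hfin : ∀ b ∈ (Finset.univ : Finset Bool), ∀ n : ℤ,
        {k | k ∈ R b ∧ size (fanPoint k) = n}.Finite := by
      intro b _ n
      cases b
      · exact finite_fanPoint_fiber hS n
      · exact finite_fanPoint_fiber (fun G hG => hS G (Finset.mem_insert_of_mem hG)) n
    have hunion : ({k : Flat M → ℕ | supp k = S} ∪ {k | supp k = insert F S}) =
        ⋃ b ∈ (Finset.univ : Finset Bool), R b := by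
      ext k
      simp [R, or_comm]
    have hdisj : ((Finset.univ : Finset Bool) : Set Bool).PairwiseDisjoint R := by
      intro a _ b _ hab
      rw [Function.onFun, Set.disjoint_left]
      intro k (hk : supp k = _) (hk' : supp k = _)
      have hne : S ≠ insert F S := fun h => hF (h ▸ Finset.mem_insert_self F S)
      cases a <;> cases b <;> simp_all
    have hPQ : P + Q = formalSum ({k : Flat M → ℕ | supp k = S} ∪ {k | supp k = insert F S})
        (fun k => size (fanPoint k)) fun k => LaurentPolynomial.T (-fanRk k) := by
      rw [hunion, formalSum_biUnion hdisj hfin]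
      simp [R, P, Q]
    have hfin' : ∀ n : ℤ, {k | k ∈ ({k : Flat M → ℕ | supp k = S} ∪ {k | supp k = insert F S}) ∧
        size (fanPoint k) + F.1.ncard = n}.Finite := by
      intro n
      refine ((hfin true (Finset.mem_univ _) (n - F.1.ncard)).union
        (hfin false (Finset.mem_univ _) (n - F.1.ncard))).subset ?_
      rintro k ⟨hk | hk, hn⟩
      · exact Or.inl ⟨hk, by omega⟩
      · exact Or.inr ⟨hk, by omega⟩
    -- With `m` the monomial of `F`, the recursion `Q = m (P + Q)` is then solved for `Q` using the
    -- inverse of `1 - m`.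
    have hrec : Q = flatMonomial F * (P + Q) := by
      rw [hPQ, flatMonomial, mul_assoc,
        X_pow_mul_formalSum (fun k _ => size_nonneg (fanPoint_nonneg k)), C_mul_formalSum hfin', hQ]
      refine (formalSum_eq_of_bijOn _ (bijOn_add_single hF) ?_ ?_).symm
      · exact fun k _ => (size_fanPoint_add_single k F).symm
      · intro k _
        rw [fanRk_add_single, ← LaurentPolynomial.T_add]
        congr 1
        ring
    have hinv := one_sub_flatMonomial_mul F (hS F (Finset.mem_insert_self F S))
    linear_combination (PowerSeries.invOfUnit (1 - flatMonomial F) 1) * (-hrec) + Q * hinv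

theorem toLaurent_X_sub_one_pow (n : ℕ) :
    ((Polynomial.X - 1 : Polynomial ℤ) ^ n).toLaurent = (LaurentPolynomial.T 1 - 1) ^ n := by
  simp

/-- Divisibility makes the polynomial division exact, and the `#S` factors `q - 1` of the product
restore `p`. -/
theorem nestedTerm_eq {p : Polynomial ℤ} {S : Finset (Flat M)} (hS : ∀ F ∈ S, F.1.Nonempty)
    (hp : (Polynomial.X - 1) ^ S.card ∣ p) :
    nestedTerm p S = formalSum {k : Flat M → ℕ | supp k = S} (fun k => size (fanPoint k))
      fun k => p.toLaurent * LaurentPolynomial.T (-fanRk k) := by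
  obtain ⟨r, rfl⟩ := hp
  have hmonic : ((Polynomial.X - 1 : Polynomial ℤ) ^ S.card).Monic := by
    simpa using (Polynomial.monic_X_sub_C (1 : ℤ)).pow S.card
  rw [← C_mul_formalSum (finite_fanPoint_fiber hS), ← prod_geometric hS, nestedTerm,
    Polynomial.mul_divByMonic_cancel_left r hmonic, map_mul, toLaurent_X_sub_one_pow, map_mul,
    map_pow]
  simp only [flatFactor]
  rw [Finset.prod_mul_distrib, Finset.prod_const]
  ring

theorem nestedTerm_zero (S : Finset (Flat M)) : nestedTerm 0 S = 0 := by
  simp [nestedTerm]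

theorem sum_nestedTerm (h𝒢 : IsBuildingSet M 𝒢) (p : Finset (Flat M) → Polynomial ℤ)
    {T : Finset (Finset (Flat M))} (hT : ∀ S ∈ T, IsNested 𝒢 S)
    (hp : ∀ S ∈ T, (Polynomial.X - 1) ^ S.card ∣ p S) (a : ℤ) :
    PowerSeries.C (LaurentPolynomial.T a) * ∑ S ∈ T, nestedTerm (p S) S =
      formalSum {k : Flat M → ℕ | supp k ∈ T} (fun k => size (fanPoint k))
        fun k => (p (supp k)).toLaurent * LaurentPolynomial.T (a - fanRk k) := by
  have hne : ∀ S ∈ T, ∀ F ∈ S, F.1.Nonempty := fun S hS F hF =>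
    nonempty_of_mem h𝒢 ((hT S hS).1 F hF)
  have hset : {k : Flat M → ℕ | supp k ∈ T} = ⋃ S ∈ T, {k : Flat M → ℕ | supp k = S} := by
    ext k
    simp
  have hdisj : (T : Set (Finset (Flat M))).PairwiseDisjoint
      fun S => {k : Flat M → ℕ | supp k = S} := by
    intro S _ S' _ hSS'
    rw [Function.onFun, Set.disjoint_left]
    intro k (hk : supp k = _) (hk' : supp k = _)
    exact hSS' (hk.symm.trans hk')
  rw [hset, formalSum_biUnion hdisj fun S hS => finite_fanPoint_fiber (hne S hS), Finset.mul_sum]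
  refine Finset.sum_congr rfl fun S hS => ?_
  rw [nestedTerm_eq (hne S hS) (hp S hS), C_mul_formalSum (finite_fanPoint_fiber (hne S hS))]
  refine formalSum_congr (fun _ _ => rfl) fun k (hk : supp k = S) => ?_
  rw [hk, sub_eq_add_neg, LaurentPolynomial.T_add]
  ring

/-- Common form of the three formulas: `p` is `χ` or `χ̄`, and `P` is the condition on `w` that cuts
out the nested sets in `T`. Besides divisibility, only the vanishing of `p` on matroids with loops
is needed. -/
theorem formalSum_eq_sum_nestedTerm (h𝒢 : IsBuildingSet M 𝒢) (hE : M.E = Set.univ)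
    (p : Matroid E → Polynomial ℤ) (hp0 : ∀ N e, N.IsLoop e → p N = 0) {P : (E → ℤ) → Prop}
    {T : Finset (Finset (Flat M))} (hT : ∀ S ∈ T, IsNested 𝒢 S)
    (hTP : M.closure ∅ = ∅ → ∀ k : Flat M → ℕ, IsNested 𝒢 (supp k) →
      (supp k ∈ T ↔ P (fanPoint k)))
    (hp : ∀ S ∈ T, (Polynomial.X - 1) ^ S.card ∣ p (initialNested M S)) (a : ℤ) :
    formalSum {w : E → ℤ | (∀ e, 0 ≤ w e) ∧ P w} size
        (fun w => (p (initial M w)).toLaurent * LaurentPolynomial.T (a - wt M w)) =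
      PowerSeries.C (LaurentPolynomial.T a) *
        ∑ S ∈ T, nestedTerm (p (initialNested M S)) S := by
  by_cases h0 : M.closure ∅ = ∅
  · have hTP := hTP h0
    rw [sum_nestedTerm h𝒢 (fun S => p (initialNested M S)) hT hp a]
    have hsub : fanPoint '' {k : Flat M → ℕ | supp k ∈ T} ⊆
        {w : E → ℤ | (∀ e, 0 ≤ w e) ∧ P w} := by
      rintro _ ⟨k, hk, rfl⟩
      exact ⟨fanPoint_nonneg k, (hTP k (hT _ hk)).1 hk⟩
    rw [formalSum_eq_of_subset hsub]
    · have hinj : Set.InjOn fanPoint {k : Flat M → ℕ | supp k ∈ T} :=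
        (fanPoint_injOn h𝒢).mono fun k (hk : supp k ∈ T) => hT _ hk
      refine (formalSum_eq_of_bijOn fanPoint hinj.bijOn_image (fun _ _ => rfl) ?_).symm
      intro k hk
      rw [initial_fanPoint h𝒢 (hT _ hk), wt_fanPoint h𝒢 (hT _ hk), fanRk]
    -- A weight outside the fan has an initial matroid with a loop and contributes 0.
    · rintro w ⟨hw0, hwP⟩ hw
      by_cases hl : ∃ e, (initial M w).IsLoop e
      · obtain ⟨e, he⟩ := hl
        rw [hp0 _ e he, map_zero, zero_mul]
      · push Not at hl
        obtain ⟨k, hk, rfl⟩ := exists_fanPoint_eq h𝒢 h0 hw0 (isFlat_superlevel hE hl)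
        exact absurd ⟨k, (hTP k hk).2 hwP, rfl⟩ hw
  · obtain ⟨e, he⟩ := exists_isLoop h0
    rw [formalSum_eq_zero, Finset.sum_eq_zero, mul_zero]
    · intro S _
      rw [hp0 (initialNested M S) e (isLoop_initialNested he), nestedTerm_zero]
    · intro w _
      rw [hp0 _ e (isLoop_initial he), map_zero, zero_mul]

end Expansion

/-! ### The three formulas -/

section Formulas

variable {E : Type*} [Fintype E] {M : Matroid E} {𝒢 : Set (Flat M)}

theorem mem_nested {S : Finset (Flat M)} : S ∈ nested 𝒢 ↔ IsNested 𝒢 S := by simp [nested]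

theorem mem_nestedStar {S : Finset (Flat M)} : S ∈ nestedStar 𝒢 ↔
    IsNested 𝒢 S ∧ factors 𝒢 (topFlat M) ⊆ (S : Set (Flat M)) := by simp [nestedStar]

theorem mem_nestedCirc {S : Finset (Flat M)} : S ∈ nestedCirc 𝒢 ↔
    IsNested 𝒢 S ∧ ¬ factors 𝒢 (topFlat M) ⊆ (S : Set (Flat M)) := by simp [nestedCirc]

theorem zeta_eq (h𝒢 : IsBuildingSet M 𝒢) (hE : M.E = Set.univ) : zeta M = nestedZeta M 𝒢 := by
  refine Eq.trans ?_ (formalSum_eq_sum_nestedTerm h𝒢 hE charPoly (fun _ _ => charPoly_eq_zero)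
    (P := fun _ => True) (fun S => mem_nested.1) (fun _ k hk => by simp [mem_nested, hk])
    (fun S hS => (mem_nested.1 hS).X_sub_one_pow_dvd_charPoly h𝒢 hE) _)
  simp only [and_true]
  rfl

theorem localZeta_eq (h𝒢 : IsBuildingSet M 𝒢) (hE : M.E = Set.univ) :
    localZeta M = nestedLocalZeta M 𝒢 := by
  refine Eq.trans ?_ (formalSum_eq_sum_nestedTerm h𝒢 hE charPoly (fun _ _ => charPoly_eq_zero)
    (P := fun w => ∀ e, 0 < w e) (fun S hS => (mem_nestedStar.1 hS).1) (fun h0 k hk => ?_)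
    (fun S hS => (mem_nestedStar.1 hS).1.X_sub_one_pow_dvd_charPoly h𝒢 hE) _)
  · rw [localZeta]
    congr 1
    ext w
    exact ⟨fun h => ⟨fun e => (h e).le, h⟩, fun h => h.2⟩
  · rw [mem_nestedStar, hk.factors_topFlat_subset_iff h𝒢 h0 hE]
    simp [hk, fanPoint_pos_iff]

theorem iInf_eq_zero {w : E → ℤ} (h0 : ∀ e, 0 ≤ w e) {e₀ : E} (he₀ : w e₀ = 0) :
    ⨅ e, w e = 0 := by
  have : Nonempty E := ⟨e₀⟩
  exact le_antisymm (he₀ ▸ ciInf_le (Set.finite_range w).bddBelow e₀) (le_ciInf h0)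

/-- Every class has exactly one lift with minimum 0, where the reduced weight and size are the
ordinary ones. For empty `E` there is one class but no such lift, so that case is separate: there
`χ̄ = [0]_q = 0`. -/
theorem bijOn_mk [Nonempty E] :
    Set.BijOn (fun w : E → ℤ => (QuotientAddGroup.mk w : ProjLattice E))
      {w | (∀ e, 0 ≤ w e) ∧ ¬ ∀ e, 0 < w e} Set.univ := by
  refine ⟨fun _ _ => trivial, ?_, ?_⟩
  · rintro w ⟨hw0, hw⟩ w' ⟨hw0', hw'⟩ h
    obtain ⟨c, rfl⟩ := exists_of_rel (QuotientAddGroup.leftRel_apply.2 (QuotientAddGroup.eq.1 h))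
    push Not at hw hw'
    obtain ⟨e, he⟩ := hw
    obtain ⟨e', he'⟩ := hw'
    have h1 : 0 ≤ w e + c := hw0' e
    have h2 := hw0 e'
    have h3 : w e' + c ≤ 0 := he'
    have hc : c = 0 := by omega
    simp [hc]
  · intro v _
    induction v using QuotientAddGroup.induction_on with
    | H w =>
      obtain ⟨e₀, he₀⟩ := exists_eq_ciInf_of_finite (f := w)
      refine ⟨fun e => w e - ⨅ e, w e, ⟨fun e => ?_, fun h => ?_⟩, ?_⟩
      · exact sub_nonneg.2 (ciInf_le (Set.finite_range w).bddBelow e)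
      · have : 0 < w e₀ - ⨅ e, w e := h e₀
        omega
      · refine QuotientAddGroup.eq.2 (AddSubgroup.mem_zmultiples_iff.2 ⟨⨅ e, w e, ?_⟩)
        funext e
        simp

theorem redCharPoly_of_isEmpty [IsEmpty E] (N : Matroid E) : redCharPoly N = 0 := by
  have : rank N = 0 := by
    rw [rank, Set.eq_empty_of_isEmpty N.E, rk_empty]
  simp [redCharPoly, this, qInt]

theorem redZeta_eq (h𝒢 : IsBuildingSet M 𝒢) (hE : M.E = Set.univ) :
    redZeta M = nestedRedZeta M 𝒢 := by
  rcases isEmpty_or_nonempty E with hem | hne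
  · rw [redZeta, nestedRedZeta, formalSum_eq_zero, Finset.sum_eq_zero, mul_zero]
    · intro S _
      rw [redCharPoly_of_isEmpty, nestedTerm_zero]
    · intro v _
      rw [redCharPoly_of_isEmpty, map_zero, zero_mul]
  · refine Eq.trans ?_ (formalSum_eq_sum_nestedTerm h𝒢 hE redCharPoly
      (fun _ _ => redCharPoly_eq_zero) (P := fun w => ¬ ∀ e, 0 < w e)
      (fun S hS => (mem_nestedCirc.1 hS).1) (fun h0 k hk => ?_)
      (fun S hS => (mem_nestedCirc.1 hS).1.X_sub_one_pow_dvd_redCharPoly h𝒢 hE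
        (mem_nestedCirc.1 hS).2) _)
    · refine (formalSum_eq_of_bijOn _ bijOn_mk ?_ ?_).symm
      · rintro w ⟨h0, hw⟩
        push Not at hw
        obtain ⟨e, he⟩ := hw
        change size w = size w - Fintype.card E * ⨅ e, w e
        rw [iInf_eq_zero h0 (le_antisymm he (h0 e)), mul_zero, sub_zero]
      · rintro w ⟨h0, hw⟩
        push Not at hw
        obtain ⟨e, he⟩ := hw
        have : redWt M (QuotientAddGroup.mk w) = wt M w := by
          change wt M w - rank M * ⨅ e, w e = wt M w
          rw [iInf_eq_zero h0 (le_antisymm he (h0 e)), mul_zero, sub_zero]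
        rw [this]
        rfl
    · rw [mem_nestedCirc, hk.factors_topFlat_subset_iff h𝒢 h0 hE]
      simp [hk, fanPoint_pos_iff]

end Formulas

end

end MotivicZeta

theorem mainTheorem10 {E : Type*} [Fintype E] (M : Matroid E) (hE : M.E = Set.univ)
    (𝒢 : Set (MotivicZeta.Flat M)) (h𝒢 : MotivicZeta.IsBuildingSet M 𝒢) :
    -- `M_w` is the same matroid `M_S` for all `w` in the relative interior of `σ_S`
    (∀ S ∈ MotivicZeta.nested 𝒢, ∀ w ∈ intrinsicInterior ℝ (MotivicZeta.cone S),
      MotivicZeta.initial M w = MotivicZeta.initialNested M S) ∧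
    -- the quotients by powers of `q - 1` are polynomials
    (∀ S ∈ MotivicZeta.nested 𝒢, (Polynomial.X - 1) ^ S.card ∣
      MotivicZeta.charPoly (MotivicZeta.initialNested M S)) ∧
    (∀ S ∈ MotivicZeta.nestedCirc 𝒢, (Polynomial.X - 1) ^ S.card ∣
      MotivicZeta.redCharPoly (MotivicZeta.initialNested M S)) ∧
    -- the three formulas
    MotivicZeta.zeta M = MotivicZeta.nestedZeta M 𝒢 ∧
    MotivicZeta.localZeta M = MotivicZeta.nestedLocalZeta M 𝒢 ∧
    MotivicZeta.redZeta M = MotivicZeta.nestedRedZeta M 𝒢 ∧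
    -- independence of the building set
    (∀ 𝒢' : Set (MotivicZeta.Flat M), MotivicZeta.IsBuildingSet M 𝒢' →
      MotivicZeta.nestedZeta M 𝒢' = MotivicZeta.nestedZeta M 𝒢 ∧
      MotivicZeta.nestedLocalZeta M 𝒢' = MotivicZeta.nestedLocalZeta M 𝒢 ∧
      MotivicZeta.nestedRedZeta M 𝒢' = MotivicZeta.nestedRedZeta M 𝒢) := by
  open MotivicZeta in
  refine ⟨fun S hS w hw => ?_, fun S hS => ?_, fun S hS => ?_, zeta_eq h𝒢 hE, localZeta_eq h𝒢 hE,
    redZeta_eq h𝒢 hE, fun 𝒢' h𝒢' => ⟨?_, ?_, ?_⟩⟩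
  · obtain ⟨k, hk, rfl⟩ := exists_pos_of_mem_intrinsicInterior hw
    exact (mem_nested.1 hS).initial_flatSum h𝒢 hk
  · exact (mem_nested.1 hS).X_sub_one_pow_dvd_charPoly h𝒢 hE
  · exact (mem_nestedCirc.1 hS).1.X_sub_one_pow_dvd_redCharPoly h𝒢 hE (mem_nestedCirc.1 hS).2
  -- Both expressions equal the zeta function, whose definition involves no building set.
  · rw [← zeta_eq h𝒢' hE, zeta_eq h𝒢 hE]
  · rw [← localZeta_eq h𝒢' hE, localZeta_eq h𝒢 hE]
  · rw [← redZeta_eq h𝒢' hE, redZeta_eq h𝒢 hE]
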